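/- Let $\varsigma\in L^2(\mathbb{R}^2)$ be a real function with $\|\varsigma\|_2=\big(\int_{\mathbb{R}^2}|\varsigma|^2\,dx\big)^{1/2}<\sqrt{2/\pi}$. Let $W^{1,2}(\mathbb{R}^2)$ be the Sobolev space of real functions $u\in L^2(\mathbb{R}^2)$ with weak gradient $\nabla u\in L^2(\mathbb{R}^2)$, with norm $\|u\|_{1,2}=\big(\int|u|^2\,dx+\int|\nabla u|^2\,dx\big)^{1/2}$. Then the equation $\nabla^2u=e^u-\varsigma-1$ on $\mathbb{R}^2$ has a unique weak solution $u\in W^{1,2}(\mathbb{R}^2)$, that is, there is exactly one $u\in W^{1,2}(\mathbb{R}^2)$ such that $e^u$ is locally integrable and $$-\int\nabla u\cdot\nabla\varphi\,dx=\int(e^u-\varsigma-1)\,\varphi\,dx\qquad\text{for all }\varphi\in C_c^\infty(\mathbb{R}^2).$$ Moreover, the functional $S[u]=\int\big[\tfrac12|\nabla u|^2+e^u-\varsigma u-u-1\big]\,dx$ has the following properties on $W^{1,2}(\mathbb{R}^2)$. 1. $S[u]$ is finite for every $u\in W^{1,2}(\mathbb{R}^2)$ (the integrand is integrable). 2. $S$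 is strictly convex. 3. $S$ is Gateaux differentiable: at every $u$ the derivative in every direction $h$ exists and equals $(\nabla_hS)[u]=\int\big[\nabla u\cdot\nabla h+h(e^u-1)-\varsigma h\big]\,dx$, where the integrand is integrable, and it is a bounded linear functional of $h\in W^{1,2}(\mathbb{R}^2)$. 4. $S$ is coercive in the radial direction: there are $R,\delta>0$ with $(\nabla_uS)[u]\ge\delta$ for all $u$ with $\|u\|_{1,2}=R$. 5. $S$ has a unique global minimizer on $W^{1,2}(\mathbb{R}^2)$, and a function in $W^{1,2}(\mathbb{R}^2)$ is a weak solution of the equation if and only if it is a global minimizer of $S$. -/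

import Mathlib

open MeasureTheory
open scoped ContDiff

noncomputable section

/-- The Euclidean plane. -/
abbrev Plane : Type := EuclideanSpace ℝ (Fin 2)

/-- Smooth compactly supported real functions on the plane. -/
def IsTestFunction (φ : Plane → ℝ) : Prop :=
  ContDiff ℝ ∞ φ ∧ HasCompactSupport φ

/-- The partial derivative `∂ᵢ φ`, used for smooth functions. -/
def partialDeriv (i : Fin 2) (φ : Plane → ℝ) (x : Plane) : ℝ :=
  fderiv ℝ φ x (EuclideanSpace.single i 1)

/-- `G` is the weak (distributional) gradient of `u`; both will be square integrable. -/
def HasWeakGradient (u : Plane → ℝ) (G : Plane → Plane) : Prop :=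
  ∀ φ : Plane → ℝ, IsTestFunction φ → ∀ i : Fin 2,
    ∫ x, u x * partialDeriv i φ x = -∫ x, G x i * φ x

theorem IsTestFunction.memLp {φ : Plane → ℝ} (hφ : IsTestFunction φ) :
    MemLp φ 2 (volume : Measure Plane) :=
  hφ.1.continuous.memLp_of_hasCompactSupport hφ.2

theorem IsTestFunction.memLp_partialDeriv {φ : Plane → ℝ} (hφ : IsTestFunction φ) (i : Fin 2) :
    MemLp (partialDeriv i φ) 2 (volume : Measure Plane) := by
  have hc : Continuous (partialDeriv i φ) :=
    (hφ.1.continuous_fderiv (by simp)).clm_apply continuous_const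
  exact hc.memLp_of_hasCompactSupport (hφ.2.fderiv_apply (𝕜 := ℝ) _)

theorem memLp_coord {G : Plane → Plane} (hG : MemLp G 2 (volume : Measure Plane)) (i : Fin 2) :
    MemLp (fun x => G x i) 2 (volume : Measure Plane) :=
  (EuclideanSpace.proj (𝕜 := ℝ) i : Plane →L[ℝ] ℝ).comp_memLp' hG

theorem integrable_mul_partialDeriv {u : Plane → ℝ} (hu : MemLp u 2 (volume : Measure Plane))
    {φ : Plane → ℝ} (hφ : IsTestFunction φ) (i : Fin 2) :
    Integrable (fun x => u x * partialDeriv i φ x) (volume : Measure Plane) :=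
  hu.integrable_mul (hφ.memLp_partialDeriv i)

theorem integrable_coord_mul {G : Plane → Plane} (hG : MemLp G 2 (volume : Measure Plane))
    {φ : Plane → ℝ} (hφ : IsTestFunction φ) (i : Fin 2) :
    Integrable (fun x => G x i * φ x) (volume : Measure Plane) :=
  (memLp_coord hG i).integrable_mul hφ.memLp

/-- The subspace of `L²(ℝ²; ℝ) × L²(ℝ²; ℝ²)`, with the `ℓ²`-product norm, of all pairs `(u, G)`
for which `G` is the weak gradient of `u`. -/
def sobolevSubmodule : Submodule ℝ (WithLp 2
    (Lp ℝ 2 (volume : Measure Plane) × Lp Plane 2 (volume : Measure Plane))) where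
  carrier := {w | HasWeakGradient w.fst w.snd}
  zero_mem' := by
    intro φ _ i
    have h1 : ∀ᵐ x ∂(volume : Measure Plane),
        (0 : Lp ℝ 2 (volume : Measure Plane)) x * partialDeriv i φ x = 0 := by
      filter_upwards [Lp.coeFn_zero ℝ 2 (volume : Measure Plane)] with x hx
      rw [hx]
      simp
    have h2 : ∀ᵐ x ∂(volume : Measure Plane),
        (0 : Lp Plane 2 (volume : Measure Plane)) x i * φ x = 0 := by
      filter_upwards [Lp.coeFn_zero Plane 2 (volume : Measure Plane)] with x hx
      rw [hx]
      simp
    change ∫ x, (0 : Lp ℝ 2 (volume : Measure Plane)) x * partialDeriv i φ x =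
      -∫ x, (0 : Lp Plane 2 (volume : Measure Plane)) x i * φ x
    rw [integral_congr_ae h1, integral_congr_ae h2]
    simp
  add_mem' := by
    intro a b ha hb φ hφ i
    have h1 : ∀ᵐ x ∂(volume : Measure Plane), (a.fst + b.fst) x * partialDeriv i φ x =
        a.fst x * partialDeriv i φ x + b.fst x * partialDeriv i φ x := by
      filter_upwards [Lp.coeFn_add a.fst b.fst] with x hx
      rw [hx, Pi.add_apply, add_mul]
    have h2 : ∀ᵐ x ∂(volume : Measure Plane), (a.snd + b.snd) x i * φ x =
        a.snd x i * φ x + b.snd x i * φ x := by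
      filter_upwards [Lp.coeFn_add a.snd b.snd] with x hx
      rw [hx, Pi.add_apply, PiLp.add_apply, add_mul]
    change ∫ x, (a.fst + b.fst) x * partialDeriv i φ x = -∫ x, (a.snd + b.snd) x i * φ x
    rw [integral_congr_ae h1, integral_congr_ae h2,
      integral_add (integrable_mul_partialDeriv (Lp.memLp _) hφ i)
        (integrable_mul_partialDeriv (Lp.memLp _) hφ i),
      integral_add (integrable_coord_mul (Lp.memLp _) hφ i)
        (integrable_coord_mul (Lp.memLp _) hφ i), ha φ hφ i, hb φ hφ i]
    ring
  smul_mem' := by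
    intro c a ha φ hφ i
    have h1 : ∀ᵐ x ∂(volume : Measure Plane), (c • a.fst) x * partialDeriv i φ x =
        c * (a.fst x * partialDeriv i φ x) := by
      filter_upwards [Lp.coeFn_smul c a.fst] with x hx
      rw [hx, Pi.smul_apply, smul_eq_mul, mul_assoc]
    have h2 : ∀ᵐ x ∂(volume : Measure Plane), (c • a.snd) x i * φ x =
        c * (a.snd x i * φ x) := by
      filter_upwards [Lp.coeFn_smul c a.snd] with x hx
      rw [hx, Pi.smul_apply, PiLp.smul_apply, smul_eq_mul, mul_assoc]
    change ∫ x, (c • a.fst) x * partialDeriv i φ x = -∫ x, (c • a.snd) x i * φ x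
    rw [integral_congr_ae h1, integral_congr_ae h2, integral_const_mul, integral_const_mul,
      ha φ hφ i]
    ring

/-- The Sobolev space `W^{1,2}(ℝ²)` of real functions, as the space of pairs `(u, ∇u)` with `u ∈ L²`
whose weak gradient `∇u` is in `L²`. The inherited norm is the Sobolev norm (`W12.norm_eq`), its
elements are determined by their first components (`W12.ext_of_toFun`), and every square integrable
function with a square integrable weak gradient occurs (`W12.exists_of_hasWeakGradient`). -/
abbrev W12 : Type := sobolevSubmodule

namespace W12

/-- The function `u` underlying an element of `W^{1,2}`. -/
def toFun (u : W12) : Plane → ℝ := u.1.fst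

/-- The weak gradient `∇u` of an element `u` of `W^{1,2}`. -/
def grad (u : W12) : Plane → Plane := u.1.snd

theorem hasWeakGradient (u : W12) : HasWeakGradient u.toFun u.grad := u.2

/-- The norm of `W^{1,2}` is the usual one. -/
theorem norm_eq (u : W12) :
    ‖u‖ = Real.sqrt ((∫ x, |u.toFun x| ^ 2) + ∫ x, ‖u.grad x‖ ^ 2) := by
  have key : ∀ {F : Type} [NormedAddCommGroup F] (f : Lp F 2 (volume : Measure Plane)),
      ‖f‖ ^ 2 = ∫ x, ‖f x‖ ^ 2 := by
    intro F _ f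
    have hnn : 0 ≤ ∫ x, ‖f x‖ ^ 2 := integral_nonneg fun x => by positivity
    rw [Lp.norm_def, (Lp.memLp f).eLpNorm_eq_integral_rpow_norm (by norm_num) (by norm_num),
      ENNReal.toReal_ofReal (by positivity)]
    simp only [ENNReal.toReal_ofNat, Real.rpow_two]
    rw [← one_div, ← Real.sqrt_eq_rpow, Real.sq_sqrt hnn]
  change ‖u.1‖ = _
  rw [WithLp.prod_norm_eq_of_L2, key, key]
  rfl

/-- An element of `W^{1,2}` is determined by its underlying function up to null sets. -/
theorem ext_of_toFun {u v : W12} (h : u.toFun =ᵐ[volume] v.toFun) : u = v := by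
  have hfst : u.1.fst = v.1.fst := Lp.ext h
  have hcoord : ∀ i : Fin 2, ∀ᵐ x ∂(volume : Measure Plane), u.grad x i - v.grad x i = 0 := by
    intro i
    have hu : MemLp (fun x => u.grad x i) 2 (volume : Measure Plane) :=
      memLp_coord (Lp.memLp u.1.snd) i
    have hv : MemLp (fun x => v.grad x i) 2 (volume : Measure Plane) :=
      memLp_coord (Lp.memLp v.1.snd) i
    refine ae_eq_zero_of_integral_contDiff_smul_eq_zero
      ((hu.sub hv).locallyIntegrable (by norm_num)) ?_
    intro g hg hgs
    have hφ : IsTestFunction g := ⟨hg, hgs⟩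
    have e1 := u.hasWeakGradient g hφ i
    have e2 := v.hasWeakGradient g hφ i
    have e3 : ∫ x, u.toFun x * partialDeriv i g x = ∫ x, v.toFun x * partialDeriv i g x := by
      refine integral_congr_ae ?_
      filter_upwards [h] with x hx
      rw [hx]
    have e4 : ∀ x, g x • (u.grad x i - v.grad x i) = u.grad x i * g x - v.grad x i * g x := by
      intro x
      simp only [smul_eq_mul]
      ring
    simp_rw [e4]
    have i1 : Integrable (fun x => u.grad x i * g x) (volume : Measure Plane) :=
      integrable_coord_mul (Lp.memLp u.1.snd) hφ i
    have i2 : Integrable (fun x => v.grad x i * g x) (volume : Measure Plane) :=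
      integrable_coord_mul (Lp.memLp v.1.snd) hφ i
    rw [integral_sub i1 i2]
    linarith
  have hsnd : u.1.snd = v.1.snd := by
    refine Lp.ext ?_
    filter_upwards [hcoord 0, hcoord 1] with x h0 h1
    ext i
    fin_cases i
    · exact sub_eq_zero.mp h0
    · exact sub_eq_zero.mp h1
  refine Subtype.ext ?_
  apply (WithLp.equiv 2 _).injective
  exact Prod.ext hfst hsnd

/-- Every square integrable function with a square integrable weak gradient is in `W^{1,2}`. -/
theorem exists_of_hasWeakGradient {f : Plane → ℝ} {G : Plane → Plane}
    (hf : MemLp f 2 (volume : Measure Plane)) (hG : MemLp G 2 (volume : Measure Plane))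
    (h : HasWeakGradient f G) :
    ∃ u : W12, u.toFun =ᵐ[volume] f ∧ u.grad =ᵐ[volume] G := by
  refine ⟨⟨WithLp.toLp 2 (hf.toLp f, hG.toLp G), ?_⟩, hf.coeFn_toLp, hG.coeFn_toLp⟩
  intro φ hφ i
  have h1 : ∀ᵐ x ∂(volume : Measure Plane),
      hf.toLp f x * partialDeriv i φ x = f x * partialDeriv i φ x := by
    filter_upwards [hf.coeFn_toLp] with x hx
    rw [hx]
  have h2 : ∀ᵐ x ∂(volume : Measure Plane), hG.toLp G x i * φ x = G x i * φ x := by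
    filter_upwards [hG.coeFn_toLp] with x hx
    rw [hx]
  change ∫ x, hf.toLp f x * partialDeriv i φ x = -∫ x, hG.toLp G x i * φ x
  rw [integral_congr_ae h1, integral_congr_ae h2]
  exact h φ hφ i

end W12

/-- `u ∈ W^{1,2}(ℝ²)` is a weak solution of `∇²u = e^u - ς - 1` on the plane. -/
def IsWeakSolution (ς : Plane → ℝ) (u : W12) : Prop :=
  LocallyIntegrable (fun x => Real.exp (u.toFun x)) (volume : Measure Plane) ∧
  ∀ φ : Plane → ℝ, IsTestFunction φ →
    -∫ x, ∑ i : Fin 2, u.grad x i * partialDeriv i φ x =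
      ∫ x, (Real.exp (u.toFun x) - ς x - 1) * φ x

/-- The integrand of the functional `S[u]`. -/
def actionDensity (ς : Plane → ℝ) (u : W12) (x : Plane) : ℝ :=
  (1 / 2) * ‖u.grad x‖ ^ 2 + Real.exp (u.toFun x) - ς x * u.toFun x - u.toFun x - 1

/-- The functional `S[u] = ∫ [½|∇u|² + e^u - ςu - u - 1]`. -/
def action (ς : Plane → ℝ) (u : W12) : ℝ :=
  ∫ x, actionDensity ς u x

/-- The integrand `∇u · ∇h + h (e^u - 1) - ς h` of the derivative of `S` at `u` along `h`. -/
def variationDensity (ς : Plane → ℝ) (u h : W12) (x : Plane) : ℝ :=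
  (∑ i : Fin 2, u.grad x i * h.grad x i) + h.toFun x * (Real.exp (u.toFun x) - 1)
    - ς x * h.toFun x

/-- `u` is a global minimizer of `S` on `W^{1,2}(ℝ²)`. -/
def IsGlobalMinimizer (ς : Plane → ℝ) (u : W12) : Prop :=
  ∀ v : W12, action ς u ≤ action ς v

end

/-!
The functional `S` is Gateaux differentiable, strictly convex and coercive on the Hilbert space
`W12`, so it has exactly one critical point, its minimizer; the weak equation says that the
derivative of `S` vanishes on test functions, which are dense. Three analytic facts carry this.

*Density of test functions* (`W12.dense_testSubmodule`). If `w` is orthogonal in `W12` to all test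
functions, then `w - Δw = 0` as a distribution. Cutoffs extend this to smooth functions that are
square integrable with their gradient; the equation `G - ΔG = ψ` is solved for every test function
`ψ` by a Schwartz function, through the Fourier multiplier `(1 + (2π)²‖ξ‖²)⁻¹`, and so `∫ w ψ = 0`.

*Exponential integrability* (`W12.memLp_exp_sub_one`): `e^u - 1 ∈ L²` for every `u` in `W12`.
The inequality `‖g‖₂ ≤ C ‖∇g‖₁` applied to powers of a test function bounds its moments
`∫ φ^(2k)` by `(C ‖∇φ‖₂²)^(k-1) (k!)² ‖φ‖₂²`. This is summable against `4^k / (2k)!` when `‖∇φ‖₂`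
is small, which settles functions of small norm. An arbitrary `u` is a test function, which is
bounded, plus a function of small norm. It follows that the density of `S` and its variations are
integrable, and that one may differentiate under the integral sign (`hasLineDerivAt_action`).

*Coercivity* (`exists_le_actionDeriv_self`). The pointwise bound `t (e^t - 1) ≥ t² / (1 + |t|)` and
the estimate `∫ u⁴ ≤ C ‖∇u‖₂² ‖u‖₂²` give `∫ u (e^u - 1) ≥ ‖u‖₂² / M` where `M` grows only linearly
in `‖∇u‖₂`. Hence `∫ u (e^u - 1) + ‖∇u‖₂²` exceeds `‖ς‖₂ ‖u‖₂` on large spheres.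

Convexity enters as the strict tangent inequality `S u + S'(u) (v - u) < S v` for `u ≠ v`
(`action_add_deriv_lt`), an integrated form of the strict convexity of `exp`. It makes the sublevel
sets of `S` intersections of closed half-spaces, so that minimizers are found by intersecting nested
bounded closed convex sets (`exists_forall_le_of_subgradient`), and it makes critical points minimal.
-/

noncomputable section

/-! ### The Hilbert space `W12` -/

/-- The classical gradient of a function on the plane. -/
def planeGradient (φ : Plane → ℝ) (x : Plane) : Plane :=
  WithLp.toLp 2 fun i => partialDeriv i φ x

@[simp]
theorem planeGradient_apply (φ : Plane → ℝ) (x : Plane) (i : Fin 2) :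
    planeGradient φ x i = partialDeriv i φ x := rfl

theorem IsTestFunction.partialDeriv {φ : Plane → ℝ} (hφ : IsTestFunction φ) (i : Fin 2) :
    IsTestFunction (partialDeriv i φ) :=
  ⟨(hφ.1.fderiv_right (m := ∞) (by simp)).clm_apply contDiff_const,
    hφ.2.fderiv_apply (𝕜 := ℝ) _⟩

theorem IsTestFunction.memLp_planeGradient {φ : Plane → ℝ} (hφ : IsTestFunction φ) :
    MemLp (planeGradient φ) 2 (volume : Measure Plane) :=
  MemLp.of_eval_piLp fun i => hφ.memLp_partialDeriv i

theorem IsTestFunction.hasWeakGradient {φ : Plane → ℝ} (hφ : IsTestFunction φ) :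
    HasWeakGradient φ (planeGradient φ) := by
  intro ψ hψ i
  refine integral_mul_fderiv_eq_neg_fderiv_mul_of_integrable
    ((hφ.memLp_partialDeriv i).integrable_mul hψ.memLp)
    (hφ.memLp.integrable_mul (hψ.memLp_partialDeriv i)) (hφ.memLp.integrable_mul hψ.memLp)
    (fun x _ => (hφ.1.differentiable (by simp)).differentiableAt)
    (fun x _ => (hψ.1.differentiable (by simp)).differentiableAt)

namespace W12

theorem memLp_toFun (u : W12) : MemLp u.toFun 2 (volume : Measure Plane) := Lp.memLp u.1.fst

theorem memLp_grad (u : W12) : MemLp u.grad 2 (volume : Measure Plane) := Lp.memLp u.1.snd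

theorem memLp_grad_coord (u : W12) (i : Fin 2) :
    MemLp (fun x => u.grad x i) 2 (volume : Measure Plane) := memLp_coord u.memLp_grad i

theorem toFun_add (u v : W12) : (u + v).toFun =ᵐ[volume] fun x => u.toFun x + v.toFun x :=
  Lp.coeFn_add u.1.fst v.1.fst

theorem toFun_sub (u v : W12) : (u - v).toFun =ᵐ[volume] fun x => u.toFun x - v.toFun x :=
  Lp.coeFn_sub u.1.fst v.1.fst

theorem toFun_smul (c : ℝ) (u : W12) : (c • u).toFun =ᵐ[volume] fun x => c * u.toFun x :=
  Lp.coeFn_smul c u.1.fst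

theorem grad_add (u v : W12) : (u + v).grad =ᵐ[volume] fun x => u.grad x + v.grad x :=
  Lp.coeFn_add u.1.snd v.1.snd

theorem grad_sub (u v : W12) : (u - v).grad =ᵐ[volume] fun x => u.grad x - v.grad x :=
  Lp.coeFn_sub u.1.snd v.1.snd

theorem grad_smul (c : ℝ) (u : W12) : (c • u).grad =ᵐ[volume] fun x => c • u.grad x :=
  Lp.coeFn_smul c u.1.snd

theorem toFun_zero : (0 : W12).toFun =ᵐ[volume] fun _ => 0 :=
  Lp.coeFn_zero ℝ 2 volume

theorem toFun_neg (u : W12) : (-u).toFun =ᵐ[volume] fun x => -u.toFun x :=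
  Lp.coeFn_neg u.1.fst

/-- The norm of `W12` as a sum of squared `L²` norms. -/
theorem norm_sq_eq (u : W12) :
    ‖u‖ ^ 2 = (∫ x, u.toFun x ^ 2) + ∫ x, ‖u.grad x‖ ^ 2 := by
  rw [norm_eq, Real.sq_sqrt]
  · simp
  · exact add_nonneg (integral_nonneg fun x => by positivity)
      (integral_nonneg fun x => by positivity)

/-- The inclusion of `W^{1,2}` into `L²`. -/
def toL2 : W12 →L[ℝ] Lp ℝ 2 (volume : Measure Plane) :=
  (WithLp.fstL 2 ℝ _ _).comp sobolevSubmodule.subtypeL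

/-- The weak gradient as a continuous linear map into `L²`. -/
def gradL2 : W12 →L[ℝ] Lp Plane 2 (volume : Measure Plane) :=
  (WithLp.sndL 2 ℝ _ _).comp sobolevSubmodule.subtypeL

theorem coeFn_toL2 (u : W12) : (toL2 u : Plane → ℝ) = u.toFun := rfl

theorem coeFn_gradL2 (u : W12) : (gradL2 u : Plane → Plane) = u.grad := rfl

theorem inner_plane (a b : Plane) : inner ℝ a b = ∑ i : Fin 2, a i * b i := by
  simp [PiLp.inner_apply, mul_comm]

theorem inner_gradL2 (u v : W12) :
    inner ℝ (gradL2 u) (gradL2 v) = ∫ x, ∑ i : Fin 2, u.grad x i * v.grad x i := by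
  simp_rw [L2.inner_def, inner_plane, coeFn_gradL2]

theorem inner_toL2 (u v : W12) : inner ℝ (toL2 u) (toL2 v) = ∫ x, u.toFun x * v.toFun x := by
  simp_rw [L2.inner_def, coeFn_toL2]
  simp [mul_comm]

theorem inner_eq (u v : W12) :
    inner ℝ u v = inner ℝ (toL2 u) (toL2 v) + inner ℝ (gradL2 u) (gradL2 v) := by
  change inner ℝ u.1 v.1 = _
  rw [WithLp.prod_inner_apply]
  rfl

theorem integrable_sum_grad_mul (u v : W12) :
    Integrable (fun x => ∑ i : Fin 2, u.grad x i * v.grad x i) (volume : Measure Plane) :=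
  integrable_finsetSum _ fun i _ => (u.memLp_grad_coord i).integrable_mul (v.memLp_grad_coord i)

end W12

/-- The weak-gradient condition against `φ` in direction `i` is orthogonality to a fixed
vector, hence a closed condition. -/
theorem isClosed_sobolevSubmodule : IsClosed (sobolevSubmodule : Set (WithLp 2
    (Lp ℝ 2 (volume : Measure Plane) × Lp Plane 2 (volume : Measure Plane)))) := by
  have hvec : ∀ (φ : Plane → ℝ) (_ : IsTestFunction φ) (i : Fin 2),
      MemLp (fun x => EuclideanSpace.single i (φ x) : Plane → Plane) 2
        (volume : Measure Plane) := by
    intro φ hφ i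
    refine MemLp.of_eval_piLp fun j => ?_
    by_cases h : j = i
    · subst h
      simpa using hφ.memLp
    · simp [h]
  have heq : (sobolevSubmodule : Set (WithLp 2
      (Lp ℝ 2 (volume : Measure Plane) × Lp Plane 2 (volume : Measure Plane)))) =
      ⋂ (φ : Plane → ℝ) (hφ : IsTestFunction φ) (i : Fin 2),
        {w | inner ℝ (WithLp.toLp 2 ((hφ.memLp_partialDeriv i).toLp _,
          (hvec φ hφ i).toLp _)) w = 0} := by
    ext w
    simp only [Set.mem_iInter, Set.mem_ofPred_eq]
    change HasWeakGradient w.fst w.snd ↔ _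
    refine forall_congr' fun φ => forall_congr' fun hφ => forall_congr' fun i => ?_
    rw [WithLp.prod_inner_apply, L2.inner_def, L2.inner_def]
    have h1 : ∫ x, inner ℝ ((hφ.memLp_partialDeriv i).toLp _ x) (w.fst x) =
        ∫ x, w.fst x * partialDeriv i φ x := by
      refine integral_congr_ae ?_
      filter_upwards [(hφ.memLp_partialDeriv i).coeFn_toLp] with x hx
      rw [hx]
      simp
    have h2 : ∫ x, inner ℝ ((hvec φ hφ i).toLp _ x) (w.snd x) = ∫ x, w.snd x i * φ x := by
      refine integral_congr_ae ?_
      filter_upwards [(hvec φ hφ i).coeFn_toLp] with x hx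
      rw [hx]
      simp [EuclideanSpace.inner_single_left, mul_comm]
    change _ ↔ (∫ x, inner ℝ ((hφ.memLp_partialDeriv i).toLp _ x) (w.fst x)) +
      (∫ x, inner ℝ ((hvec φ hφ i).toLp _ x) (w.snd x)) = 0
    rw [h1, h2, eq_neg_iff_add_eq_zero]
  rw [heq]
  exact isClosed_iInter fun φ => isClosed_iInter fun hφ => isClosed_iInter fun i =>
    isClosed_eq (continuous_const.inner continuous_id) continuous_const

instance : CompleteSpace W12 := isClosed_sobolevSubmodule.completeSpace_coe

namespace W12

/-- A test function as an element of `W^{1,2}`. -/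
def ofTest {φ : Plane → ℝ} (hφ : IsTestFunction φ) : W12 :=
  (exists_of_hasWeakGradient hφ.memLp hφ.memLp_planeGradient hφ.hasWeakGradient).choose

theorem ofTest_toFun {φ : Plane → ℝ} (hφ : IsTestFunction φ) : (ofTest hφ).toFun =ᵐ[volume] φ :=
  (exists_of_hasWeakGradient hφ.memLp hφ.memLp_planeGradient hφ.hasWeakGradient).choose_spec.1

theorem ofTest_grad {φ : Plane → ℝ} (hφ : IsTestFunction φ) :
    (ofTest hφ).grad =ᵐ[volume] planeGradient φ :=
  (exists_of_hasWeakGradient hφ.memLp hφ.memLp_planeGradient hφ.hasWeakGradient).choose_spec.2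

end W12

/-! ### Density of the test functions -/

/-- A smooth cutoff, equal to `1` on the ball of radius `n + 1` about the origin. -/
def cutoff (n : ℕ) (x : Plane) : ℝ :=
  (⟨1, 2, one_pos, one_lt_two⟩ : ContDiffBump (0 : Plane)) (((n : ℝ) + 1)⁻¹ • x)

theorem cutoff_contDiff (n : ℕ) : ContDiff ℝ ∞ (cutoff n) :=
  (ContDiffBump.contDiff _).comp (contDiff_const_smul _)

theorem cutoff_hasCompactSupport (n : ℕ) : HasCompactSupport (cutoff n) :=
  (ContDiffBump.hasCompactSupport _).comp_smul (by positivity)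

theorem abs_cutoff_le (n : ℕ) (x : Plane) : |cutoff n x| ≤ 1 := by
  rw [cutoff, abs_of_nonneg (ContDiffBump.nonneg _)]
  exact ContDiffBump.le_one _

theorem tendsto_cutoff (x : Plane) :
    Filter.Tendsto (fun n => cutoff n x) Filter.atTop (nhds 1) := by
  obtain ⟨N, hN⟩ := exists_nat_ge ‖x‖
  refine tendsto_const_nhds.congr' ?_
  filter_upwards [Filter.eventually_ge_atTop N] with n hn
  refine (ContDiffBump.one_of_mem_closedBall _ ?_).symm
  have hn' : (N : ℝ) ≤ n := by exact_mod_cast hn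
  rw [mem_closedBall_zero_iff, norm_smul, norm_inv, Real.norm_of_nonneg (by positivity),
    inv_mul_le_iff₀ (by positivity)]
  linarith

theorem exists_abs_partialDeriv_cutoff_le :
    ∃ C : ℝ, ∀ n i x, |partialDeriv i (cutoff n) x| ≤ C * ((n : ℝ) + 1)⁻¹ := by
  set f : ContDiffBump (0 : Plane) := ⟨1, 2, one_pos, one_lt_two⟩
  have hf : ContDiff ℝ ∞ f := f.contDiff
  obtain ⟨C, hC⟩ := (f.hasCompactSupport.fderiv (𝕜 := ℝ)).exists_bound_of_continuous
    (hf.continuous_fderiv (by simp))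
  refine ⟨C, fun n i x => ?_⟩
  have h : partialDeriv i (cutoff n) x =
      ((n : ℝ) + 1)⁻¹ * fderiv ℝ f (((n : ℝ) + 1)⁻¹ • x) (EuclideanSpace.single i 1) := by
    have := fderiv_comp_smul (f := f) (x := x) ((n : ℝ) + 1)⁻¹
    change fderiv ℝ (fun y => f (((n : ℝ) + 1)⁻¹ • y)) x _ = _
    rw [this]
    simp
  rw [h, abs_mul, abs_of_nonneg (by positivity), mul_comm]
  gcongr
  refine ((fderiv ℝ f (((n : ℝ) + 1)⁻¹ • x)).le_opNorm _).trans ?_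
  simpa using hC (((n : ℝ) + 1)⁻¹ • x)

theorem partialDeriv_mul {φ ψ : Plane → ℝ} (hφ : ContDiff ℝ ∞ φ) (hψ : ContDiff ℝ ∞ ψ)
    (i : Fin 2) (x : Plane) : partialDeriv i (fun y => φ y * ψ y) x =
      φ x * partialDeriv i ψ x + partialDeriv i φ x * ψ x := by
  have := fderiv_fun_mul (𝕜 := ℝ) (hφ.differentiable (by simp)).differentiableAt
    (hψ.differentiable (by simp)).differentiableAt (x := x)
  simp only [partialDeriv]
  rw [this]
  simp [mul_comm]

/-- A first-order distributional identity with square integrable coefficients that holds for test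
functions holds for all smooth functions that are square integrable with their gradient. The
derivatives of the cutoffs are bounded and tend to zero, so dominated convergence applies. -/
theorem integral_eq_zero_of_forall_testFunction {A : Plane → ℝ} {B : Fin 2 → Plane → ℝ}
    (hA : MemLp A 2 (volume : Measure Plane)) (hB : ∀ i, MemLp (B i) 2 (volume : Measure Plane))
    (H : ∀ φ, IsTestFunction φ → ∫ x, (A x * φ x + ∑ i, B i x * partialDeriv i φ x) = 0)
    {g : Plane → ℝ} (hg : ContDiff ℝ ∞ g) (hg2 : MemLp g 2 (volume : Measure Plane))
    (hg' : ∀ i, MemLp (partialDeriv i g) 2 (volume : Measure Plane)) :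
    ∫ x, (A x * g x + ∑ i, B i x * partialDeriv i g x) = 0 := by
  obtain ⟨C, hC⟩ := exists_abs_partialDeriv_cutoff_le
  have hC0 : 0 ≤ C := by
    have := (abs_nonneg _).trans (hC 0 0 0)
    simpa using this
  have hCn : ∀ n i x, |partialDeriv i (cutoff n) x| ≤ C := fun n i x =>
    (hC n i x).trans (mul_le_of_le_one_right hC0 (inv_le_one_of_one_le₀ (by simp)))
  have htest : ∀ n, IsTestFunction fun x => cutoff n x * g x := fun n =>
    ⟨(cutoff_contDiff n).mul hg, (cutoff_hasCompactSupport n).mul_right⟩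
  have hlim : Filter.Tendsto (fun n => ∫ x, (A x * (cutoff n x * g x) +
      ∑ i, B i x * partialDeriv i (fun y => cutoff n y * g y) x)) Filter.atTop
      (nhds (∫ x, (A x * g x + ∑ i, B i x * partialDeriv i g x))) := by
    refine tendsto_integral_of_dominated_convergence
      (fun x => |A x| * |g x| + ∑ i, |B i x| * (|partialDeriv i g x| + C * |g x|)) ?_ ?_ ?_ ?_
    · intro n
      refine (hA.1.mul (htest n).1.continuous.aestronglyMeasurable).add ?_
      exact Finset.aestronglyMeasurable_fun_sum _ fun i _ =>
        (hB i).1.mul ((htest n).partialDeriv i).1.continuous.aestronglyMeasurable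
    · refine (hA.norm.integrable_mul hg2.norm).add (integrable_finsetSum _ fun i _ => ?_)
      exact (hB i).norm.integrable_mul ((hg' i).norm.add (hg2.norm.const_mul C))
    · intro n
      refine Filter.Eventually.of_forall fun x => ?_
      rw [Real.norm_eq_abs]
      refine (abs_add_le _ _).trans (add_le_add ?_ ((Finset.abs_sum_le_sum_abs _ _).trans
        (Finset.sum_le_sum fun i _ => ?_)))
      · rw [abs_mul, abs_mul]
        gcongr
        exact mul_le_of_le_one_left (abs_nonneg _) (abs_cutoff_le n x)
      · rw [abs_mul, partialDeriv_mul (cutoff_contDiff n) hg]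
        gcongr
        refine (abs_add_le _ _).trans ?_
        rw [abs_mul, abs_mul]
        gcongr
        · exact mul_le_of_le_one_left (abs_nonneg _) (abs_cutoff_le n x)
        · exact hCn n i x
    · refine Filter.Eventually.of_forall fun x => ?_
      have h0 : ∀ i, Filter.Tendsto (fun n => partialDeriv i (cutoff n) x) Filter.atTop
          (nhds 0) := by
        intro i
        refine squeeze_zero_norm (fun n => hC n i x) ?_
        have := (tendsto_one_div_add_atTop_nhds_zero_nat (𝕜 := ℝ)).const_mul C
        simpa using this
      simp_rw [partialDeriv_mul (cutoff_contDiff _) hg]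
      have h1 : Filter.Tendsto (fun n => A x * (cutoff n x * g x)) Filter.atTop
          (nhds (A x * g x)) := by
        simpa using ((tendsto_cutoff x).mul_const (g x)).const_mul (A x)
      refine h1.add (tendsto_finsetSum _ fun i _ => ?_)
      have := (((tendsto_cutoff x).mul_const (partialDeriv i g x)).add
        ((h0 i).mul_const (g x))).const_mul (B i x)
      simpa using this
  simp_rw [H _ (htest _)] at hlim
  exact (tendsto_nhds_unique hlim tendsto_const_nhds)

open SchwartzMap in
open scoped Laplacian LineDeriv FourierTransform in
/-- The operator `1 - Δ` is onto on complex Schwartz functions: its inverse is the Fourier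
multiplier with symbol `(1 + (2π)²‖ξ‖²)⁻¹`. -/
theorem exists_sub_laplacian_eq (f : 𝓢(Plane, ℂ)) : ∃ G : 𝓢(Plane, ℂ), G - Δ G = f := by
  set m : Plane → ℝ := fun x => (1 + ‖(2 * Real.pi) • x‖ ^ 2) ^ (-1 : ℝ)
  have hm : m.HasTemperateGrowth :=
    (Function.hasTemperateGrowth_one_add_norm_sq_rpow Plane (-1)).comp
      ((2 * Real.pi) • ContinuousLinearMap.id ℝ Plane).hasTemperateGrowth
  have hn : ((‖·‖ ^ 2 : Plane → ℝ)).HasTemperateGrowth := by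
    fun_prop
  refine ⟨fourierMultiplierCLM ℂ m f, ?_⟩
  rw [laplacian_eq_fourierMultiplierCLM, fourierMultiplierCLM_fourierMultiplierCLM_apply hn hm,
    neg_smul, sub_neg_eq_add]
  have h1 : (2 * Real.pi) ^ 2 • fourierMultiplierCLM ℂ ((‖·‖ ^ 2 : Plane → ℝ) * m) f =
      fourierMultiplierCLM ℂ ((2 * Real.pi) ^ 2 • ((‖·‖ ^ 2 : Plane → ℝ) * m)) f := by
    rw [fourierMultiplierCLM_smul (hn.mul hm)]
    rfl
  have h2 : f = fourierMultiplierCLM ℂ (fun _ : Plane => (1 : ℝ)) f := by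
    rw [fourierMultiplierCLM_const]
    simp
  rw [h1]
  conv_rhs => rw [h2]
  have h3 : m + (2 * Real.pi) ^ 2 • ((‖·‖ ^ 2 : Plane → ℝ) * m) = fun _ => 1 := by
    funext x
    have hpos : (1 + ‖(2 * Real.pi) • x‖ ^ 2) ≠ 0 := by positivity
    simp only [m, Pi.add_apply, Pi.smul_apply, Pi.mul_apply, smul_eq_mul,
      Real.rpow_neg_one]
    have hx : ‖(2 * Real.pi) • x‖ ^ 2 = (2 * Real.pi) ^ 2 * ‖x‖ ^ 2 := by
      rw [norm_smul, mul_pow, Real.norm_eq_abs, sq_abs]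
    rw [hx] at hpos ⊢
    field_simp
  have hmn : ((2 * Real.pi) ^ 2 • ((‖·‖ ^ 2 : Plane → ℝ) * m)).HasTemperateGrowth :=
    (Function.HasTemperateGrowth.const ((2 * Real.pi) ^ 2)).mul (hn.mul hm)
  rw [← h3]
  simp only [fourierMultiplierCLM_apply]
  rw [smulLeftCLM_add hm hmn, add_apply, FourierTransform.fourierInv_add]

open SchwartzMap in
theorem SchwartzMap.contDiff_re (G : 𝓢(Plane, ℂ)) : ContDiff ℝ ∞ fun x => (G x).re :=
  Complex.reCLM.contDiff.comp (G.smooth ⊤)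

open SchwartzMap in
theorem SchwartzMap.memLp_re (G : 𝓢(Plane, ℂ)) :
    MemLp (fun x => (G x).re) 2 (volume : Measure Plane) :=
  (G.memLp 2).re

open SchwartzMap in
open scoped LineDeriv in
theorem SchwartzMap.partialDeriv_re (G : 𝓢(Plane, ℂ)) (i : Fin 2) :
    partialDeriv i (fun x => (G x).re) =
      fun x => ((∂_{(EuclideanSpace.single i 1 : Plane)} G) x).re := by
  funext x
  rw [lineDerivOp_apply_eq_fderiv]
  have h := Complex.reCLM.hasFDerivAt.comp x (G.differentiable x).hasFDerivAt
  have h' := h.fderiv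
  change fderiv ℝ (fun x => (G x).re) x = _ at h'
  rw [partialDeriv, h']
  rfl

namespace W12

/-- If `w` is orthogonal to all test functions then `w - Δw = 0` in the sense of distributions.
Pairing with the real part of the Schwartz solution `G` of `G - ΔG = ψ` gives `∫ w ψ = 0`. -/
theorem eq_zero_of_inner_ofTest_eq_zero {w : W12}
    (H : ∀ (φ : Plane → ℝ) (hφ : IsTestFunction φ), inner ℝ w (ofTest hφ) = 0) : w = 0 := by
  have hE1 : ∀ φ, IsTestFunction φ →
      ∫ x, (w.toFun x * φ x + ∑ i, w.grad x i * partialDeriv i φ x) = 0 := by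
    intro φ hφ
    have h := H φ hφ
    rw [inner_eq, inner_toL2, inner_gradL2, ← integral_add] at h
    · rw [← h]
      refine integral_congr_ae ?_
      filter_upwards [ofTest_toFun hφ, ofTest_grad hφ] with x h1 h2
      rw [h1, h2]
      rfl
    · exact w.memLp_toFun.integrable_mul (memLp_toFun _)
    · exact integrable_sum_grad_mul _ _
  have hE2 : ∀ i φ, IsTestFunction φ →
      ∫ x, (w.grad x i * φ x + ∑ j, (if j = i then w.toFun x else 0) * partialDeriv j φ x) =
        0 := by
    intro i φ hφ
    have h := w.hasWeakGradient φ hφ i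
    simp only [ite_mul, zero_mul, Finset.sum_ite_eq', Finset.mem_univ, if_true]
    rw [integral_add (integrable_coord_mul w.memLp_grad hφ i)
      (integrable_mul_partialDeriv w.memLp_toFun hφ i), h]
    ring
  refine ext_of_toFun (Filter.EventuallyEq.trans ?_ toFun_zero.symm)
  refine ae_eq_zero_of_integral_contDiff_smul_eq_zero
    (w.memLp_toFun.locallyIntegrable (by norm_num)) fun ψ hψ hψs => ?_
  have hsupp : HasCompactSupport fun x => (ψ x : ℂ) := hψs.comp_left Complex.ofReal_zero
  obtain ⟨G, hG⟩ := exists_sub_laplacian_eq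
    (hsupp.toSchwartzMap (Complex.ofRealCLM.contDiff.comp hψ))
  have key1 := integral_eq_zero_of_forall_testFunction w.memLp_toFun w.memLp_grad_coord hE1
    G.contDiff_re G.memLp_re fun i => by
      rw [SchwartzMap.partialDeriv_re]
      exact SchwartzMap.memLp_re _
  have key2 : ∀ i, ∫ x, (w.grad x i * partialDeriv i (fun x => (G x).re) x +
      w.toFun x * partialDeriv i (partialDeriv i (fun x => (G x).re)) x) = 0 := by
    intro i
    have := integral_eq_zero_of_forall_testFunction (w.memLp_grad_coord i)
      (B := fun j x => if j = i then w.toFun x else 0)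
      (fun j => by by_cases h : j = i <;> simp [h, w.memLp_toFun]) (hE2 i)
      (g := partialDeriv i (fun x => (G x).re))
      (by rw [SchwartzMap.partialDeriv_re]; exact SchwartzMap.contDiff_re _)
      (by rw [SchwartzMap.partialDeriv_re]; exact SchwartzMap.memLp_re _)
      (fun j => by
        rw [SchwartzMap.partialDeriv_re, SchwartzMap.partialDeriv_re]
        exact SchwartzMap.memLp_re _)
    simpa only [ite_mul, zero_mul, Finset.sum_ite_eq', Finset.mem_univ, if_true] using this
  simp only [SchwartzMap.partialDeriv_re] at key1 key2
  have hpt : ∀ x, ψ x • w.toFun x = (w.toFun x * (G x).re + ∑ i : Fin 2, w.grad x i *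
        (LineDeriv.lineDerivOp (EuclideanSpace.single i 1 : Plane) G x).re) -
      ∑ i : Fin 2, (w.grad x i *
        (LineDeriv.lineDerivOp (EuclideanSpace.single i 1 : Plane) G x).re + w.toFun x *
        (LineDeriv.lineDerivOp (EuclideanSpace.single i 1 : Plane)
          (LineDeriv.lineDerivOp (EuclideanSpace.single i 1 : Plane) G) x).re) := by
    intro x
    have h := DFunLike.congr_fun hG x
    rw [SchwartzMap.laplacian_eq_sum (EuclideanSpace.basisFun (Fin 2) ℝ)] at h
    have h' := congrArg Complex.re h
    simp only [sub_apply, sum_apply, Complex.sub_re, Complex.re_sum,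
      EuclideanSpace.basisFun_apply] at h'
    have h'' : ψ x = (hsupp.toSchwartzMap (Complex.ofRealCLM.contDiff.comp hψ) x).re := rfl
    rw [h'', ← h', Finset.sum_add_distrib, ← Finset.mul_sum]
    simp only [smul_eq_mul]
    ring
  simp_rw [hpt]
  have hint : ∀ i : Fin 2, Integrable (fun x => w.grad x i *
        (LineDeriv.lineDerivOp (EuclideanSpace.single i 1 : Plane) G x).re)
        (volume : Measure Plane) := fun i =>
    (w.memLp_grad_coord i).integrable_mul (SchwartzMap.memLp_re _)
  have hint' : ∀ i : Fin 2, Integrable (fun x => w.grad x i *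
        (LineDeriv.lineDerivOp (EuclideanSpace.single i 1 : Plane) G x).re + w.toFun x *
        (LineDeriv.lineDerivOp (EuclideanSpace.single i 1 : Plane)
          (LineDeriv.lineDerivOp (EuclideanSpace.single i 1 : Plane) G) x).re)
        (volume : Measure Plane) := fun i =>
    (hint i).add (w.memLp_toFun.integrable_mul (SchwartzMap.memLp_re _))
  rw [integral_sub, key1, integral_finsetSum _ fun i _ => hint' i]
  · simp [key2]
  · exact (w.memLp_toFun.integrable_mul G.memLp_re).add (integrable_finsetSum _ fun i _ => hint i)
  · exact integrable_finsetSum _ fun i _ => hint' i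

/-- The test functions, as a subspace of `W^{1,2}(ℝ²)`. -/
def testSubmodule : Submodule ℝ W12 where
  carrier := {u | ∃ (φ : Plane → ℝ) (hφ : IsTestFunction φ), ofTest hφ = u}
  zero_mem' := by
    have h0 : IsTestFunction fun _ : Plane => (0 : ℝ) := ⟨contDiff_const, .zero⟩
    exact ⟨_, h0, ext_of_toFun ((ofTest_toFun h0).trans toFun_zero.symm)⟩
  add_mem' := by
    rintro _ _ ⟨φ, hφ, rfl⟩ ⟨ψ, hψ, rfl⟩
    have h : IsTestFunction fun x => φ x + ψ x := ⟨hφ.1.add hψ.1, hφ.2.add hψ.2⟩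
    refine ⟨_, h, ext_of_toFun ?_⟩
    filter_upwards [ofTest_toFun hφ, ofTest_toFun hψ, ofTest_toFun h,
      toFun_add (ofTest hφ) (ofTest hψ)] with x h1 h2 h3 h4
    rw [h3, h4, h1, h2]
  smul_mem' := by
    rintro c _ ⟨φ, hφ, rfl⟩
    have h : IsTestFunction fun x => c * φ x := ⟨contDiff_const.mul hφ.1, hφ.2.mul_left⟩
    refine ⟨_, h, ext_of_toFun ?_⟩
    filter_upwards [ofTest_toFun hφ, ofTest_toFun h, toFun_smul c (ofTest hφ)] with x h1 h2 h3
    rw [h2, h3, h1]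

theorem ofTest_mem_testSubmodule {φ : Plane → ℝ} (hφ : IsTestFunction φ) :
    ofTest hφ ∈ testSubmodule := ⟨φ, hφ, rfl⟩

/-- The test functions are dense in `W^{1,2}(ℝ²)`. -/
theorem dense_testSubmodule : Dense (testSubmodule : Set W12) := by
  rw [Submodule.dense_iff_topologicalClosure_eq_top, Submodule.topologicalClosure_eq_top_iff,
    Submodule.eq_bot_iff]
  intro w hw
  refine eq_zero_of_inner_ofTest_eq_zero fun φ hφ => ?_
  rw [real_inner_comm]
  exact hw _ (ofTest_mem_testSubmodule hφ)

end W12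

/-! ### Sobolev estimates: fourth powers and exponential integrability -/

/-- The Cauchy–Schwarz inequality in `L²`, squared. -/
theorem sq_integral_mul_le {f g : Plane → ℝ} (hf : MemLp f 2 (volume : Measure Plane))
    (hg : MemLp g 2 (volume : Measure Plane)) :
    (∫ x, f x * g x) ^ 2 ≤ (∫ x, f x ^ 2) * ∫ x, g x ^ 2 := by
  have key : ∀ {a b : Plane → ℝ} (ha : MemLp a 2 (volume : Measure Plane))
      (hb : MemLp b 2 (volume : Measure Plane)),
      inner ℝ (ha.toLp a) (hb.toLp b) = ∫ x, a x * b x := by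
    intro a b ha hb
    rw [L2.inner_def]
    refine integral_congr_ae ?_
    filter_upwards [ha.coeFn_toLp, hb.coeFn_toLp] with x h1 h2
    rw [h1, h2]
    simp [mul_comm]
  have h := real_inner_mul_inner_self_le (hf.toLp f) (hg.toLp g)
  rw [key hf hg, key hf hf, key hg hg] at h
  simpa only [sq] using h

theorem norm_fderiv_le_norm_planeGradient (φ : Plane → ℝ) (x : Plane) :
    ‖fderiv ℝ φ x‖ ≤ ‖planeGradient φ x‖ := by
  refine ContinuousLinearMap.opNorm_le_bound _ (norm_nonneg _) fun v => ?_
  have h : fderiv ℝ φ x v = inner ℝ (planeGradient φ x) v := by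
    conv_lhs => rw [← (EuclideanSpace.basisFun (Fin 2) ℝ).sum_repr v]
    simp [PiLp.inner_apply, partialDeriv]
  rw [h]
  exact norm_inner_le_norm _ _

theorem IsTestFunction.continuous_planeGradient {φ : Plane → ℝ} (hφ : IsTestFunction φ) :
    Continuous (planeGradient φ) :=
  (PiLp.continuous_toLp 2 _).comp (continuous_pi fun i => (hφ.partialDeriv i).1.continuous)

theorem planeGradient_pow {φ : Plane → ℝ} (hφ : IsTestFunction φ) (k : ℕ) (x : Plane) :
    planeGradient (fun y => φ y ^ (k + 1)) x = ((k + 1) * φ x ^ k) • planeGradient φ x := by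
  ext i
  have h := ((hφ.1.differentiable (by simp)).differentiableAt (x := x)).hasFDerivAt.pow (k + 1)
  have h' := h.fderiv
  simp only [planeGradient_apply, PiLp.smul_apply, partialDeriv, smul_eq_mul]
  change fderiv ℝ (fun y => φ y ^ (k + 1)) x _ = _
  change fderiv ℝ (fun y => φ y ^ (k + 1)) x = _ at h'
  rw [h']
  simp

theorem IsTestFunction.pow {φ : Plane → ℝ} (hφ : IsTestFunction φ) (k : ℕ) :
    IsTestFunction fun y => φ y ^ (k + 1) :=
  ⟨hφ.1.pow _, hφ.2.comp_left (g := fun t : ℝ => t ^ (k + 1)) (by simp)⟩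

/-- The Gagliardo–Nirenberg–Sobolev inequality `‖g‖₂ ≤ C ‖∇g‖₁` on the plane. -/
theorem exists_integral_sq_le :
    ∃ C : ℝ, 0 ≤ C ∧ ∀ g : Plane → ℝ, IsTestFunction g →
      ∫ x, g x ^ 2 ≤ C * (∫ x, ‖planeGradient g x‖) ^ 2 := by
  refine ⟨lintegralPowLePowLIntegralFDerivConst (volume : Measure Plane) 2, NNReal.coe_nonneg _,
    fun g hg => ?_⟩
  have hp : Real.HolderConjugate (Module.finrank ℝ Plane) 2 := by
    rw [finrank_euclideanSpace_fin]
    exact_mod_cast Real.HolderConjugate.two_two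
  have h := lintegral_pow_le_pow_lintegral_fderiv (volume : Measure Plane)
    (hg.1.of_le (by simp)) hg.2 hp
  have hint : Integrable (fun x => ‖planeGradient g x‖) (volume : Measure Plane) := by
    refine (hg.continuous_planeGradient.norm).integrable_of_hasCompactSupport ?_
    refine HasCompactSupport.intro hg.2 fun x hx => ?_
    have h0 : fderiv ℝ g x = 0 := by
      by_contra hne
      exact hx (support_fderiv_subset ℝ hne)
    rw [norm_eq_zero]
    ext i
    simp [partialDeriv, h0]
  have h1 : ∫⁻ x, ‖g x‖ₑ ^ (2 : ℝ) = ENNReal.ofReal (∫ x, g x ^ 2) := by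
    rw [ofReal_integral_eq_lintegral_ofReal hg.memLp.integrable_sq
      (Filter.Eventually.of_forall fun x => sq_nonneg _)]
    refine lintegral_congr fun x => ?_
    rw [ENNReal.rpow_two, ← ofReal_norm, ← ENNReal.ofReal_pow (norm_nonneg _),
      Real.norm_eq_abs, sq_abs]
  have h2 : ∫⁻ x, ‖fderiv ℝ g x‖ₑ ≤ ENNReal.ofReal (∫ x, ‖planeGradient g x‖) := by
    rw [ofReal_integral_eq_lintegral_ofReal hint
      (Filter.Eventually.of_forall fun x => norm_nonneg _)]
    refine lintegral_mono fun x => ?_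
    rw [← ofReal_norm]
    exact ENNReal.ofReal_le_ofReal (norm_fderiv_le_norm_planeGradient g x)
  rw [h1] at h
  have hnn : 0 ≤ ∫ x, ‖planeGradient g x‖ := integral_nonneg fun x => norm_nonneg _
  refine (ENNReal.ofReal_le_ofReal_iff (by positivity)).1 (h.trans ?_)
  rw [ENNReal.ofReal_mul (NNReal.coe_nonneg _), ENNReal.ofReal_coe_nnreal, ENNReal.rpow_two,
    ENNReal.ofReal_pow hnn]
  gcongr

/-- Moments of a test function satisfy a recursion: the Sobolev inequality for `φ ^ (k + 1)`
followed by the Cauchy–Schwarz inequality. -/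
theorem exists_integral_pow_le :
    ∃ C : ℝ, 0 < C ∧ ∀ φ : Plane → ℝ, IsTestFunction φ → ∀ k : ℕ,
      ∫ x, φ x ^ (2 * (k + 2)) ≤
        C * (k + 2) ^ 2 * (∫ x, ‖planeGradient φ x‖ ^ 2) * ∫ x, φ x ^ (2 * (k + 1)) := by
  obtain ⟨C, hC, h⟩ := exists_integral_sq_le
  refine ⟨C + 1, by positivity, fun φ hφ k => ?_⟩
  have h1 := h _ (hφ.pow (k + 1))
  have h2 : ∀ x, ‖planeGradient (fun y => φ y ^ (k + 1 + 1)) x‖ =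
      ((k : ℝ) + 2) * (|φ x ^ (k + 1)| * ‖planeGradient φ x‖) := by
    intro x
    rw [planeGradient_pow hφ, norm_smul, norm_mul, Real.norm_eq_abs, Real.norm_eq_abs,
      abs_of_nonneg (by positivity)]
    push_cast
    ring
  have h3 := sq_integral_mul_le (hφ.pow k).memLp.norm hφ.memLp_planeGradient.norm
  simp only [Real.norm_eq_abs, sq_abs] at h3
  simp_rw [h2, integral_const_mul] at h1
  have e1 : ∀ x, (φ x ^ (k + 1 + 1)) ^ 2 = φ x ^ (2 * (k + 2)) := fun x => by ring
  have e2 : ∀ x, (φ x ^ (k + 1)) ^ 2 = φ x ^ (2 * (k + 1)) := fun x => by ring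
  simp_rw [e1] at h1
  simp_rw [e2] at h3
  have hnn : 0 ≤ (∫ x, φ x ^ (2 * (k + 1))) * ∫ x, ‖planeGradient φ x‖ ^ 2 :=
    (sq_nonneg _).trans h3
  calc ∫ x, φ x ^ (2 * (k + 2))
      ≤ C * ((k + 2) * ∫ x, |φ x ^ (k + 1)| * ‖planeGradient φ x‖) ^ 2 := h1
    _ = C * (k + 2) ^ 2 * (∫ x, |φ x ^ (k + 1)| * ‖planeGradient φ x‖) ^ 2 := by ring
    _ ≤ (C + 1) * (k + 2) ^ 2 *
        ((∫ x, φ x ^ (2 * (k + 1))) * ∫ x, ‖planeGradient φ x‖ ^ 2) := by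
      gcongr
      simp
    _ = _ := by ring

/-- The moment recursion, iterated down to `∫ φ²`. -/
theorem exists_integral_pow_le_factorial :
    ∃ C : ℝ, 0 < C ∧ ∀ φ : Plane → ℝ, IsTestFunction φ → ∀ k : ℕ,
      ∫ x, φ x ^ (2 * (k + 1)) ≤
        (C * ∫ x, ‖planeGradient φ x‖ ^ 2) ^ k * ((k + 1).factorial : ℝ) ^ 2 * ∫ x, φ x ^ 2 := by
  obtain ⟨C, hC, h⟩ := exists_integral_pow_le
  refine ⟨C, hC, fun φ hφ k => ?_⟩
  have hD : 0 ≤ ∫ x, ‖planeGradient φ x‖ ^ 2 := integral_nonneg fun x => by positivity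
  induction k with
  | zero => simp
  | succ k ih =>
    refine (h φ hφ k).trans ?_
    rw [Nat.factorial_succ (k + 1)]
    push_cast
    calc C * ((k : ℝ) + 2) ^ 2 * (∫ x, ‖planeGradient φ x‖ ^ 2) * ∫ x, φ x ^ (2 * (k + 1))
        ≤ C * ((k : ℝ) + 2) ^ 2 * (∫ x, ‖planeGradient φ x‖ ^ 2) *
          ((C * ∫ x, ‖planeGradient φ x‖ ^ 2) ^ k * ((k + 1).factorial : ℝ) ^ 2 *
            ∫ x, φ x ^ 2) := by gcongr
      _ = _ := by ring

theorem sq_exp_sub_one_le (t : ℝ) : (Real.exp t - 1) ^ 2 ≤ 2 * (Real.cosh (2 * t) - 1) := by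
  rw [Real.cosh_eq]
  have h1 := Real.add_one_le_exp (-(2 * t))
  have h2 : Real.exp (2 * t) = Real.exp t ^ 2 := by rw [← Real.exp_nat_mul]; norm_num
  have h3 := Real.add_one_le_exp t
  rw [h2]
  nlinarith

/-- Exponential integrability for test functions with small gradient: the power series of
`cosh (2φ) - 1` is integrated termwise, and the moment bounds dominate it by a geometric series. -/
theorem exists_integral_cosh_le :
    ∃ ε : ℝ, 0 < ε ∧ ∀ φ : Plane → ℝ, IsTestFunction φ → ∫ x, ‖planeGradient φ x‖ ^ 2 ≤ ε →
      ∫ x, (Real.cosh (2 * φ x) - 1) ≤ 8 * ∫ x, φ x ^ 2 := by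
  obtain ⟨C, hC, h⟩ := exists_integral_pow_le_factorial
  refine ⟨1 / (8 * C), by positivity, fun φ hφ hD => ?_⟩
  have hD0 : 0 ≤ ∫ x, ‖planeGradient φ x‖ ^ 2 := integral_nonneg fun x => by positivity
  have hM0 : 0 ≤ ∫ x, φ x ^ 2 := integral_nonneg fun x => by positivity
  set F : ℕ → Plane → ℝ := fun k x => (2 * φ x) ^ (2 * (k + 1)) / (2 * (k + 1)).factorial with hF
  have hFnn : ∀ k x, 0 ≤ F k x := fun k x => by
    simp only [hF, pow_mul]
    positivity
  have hFint : ∀ k, Integrable (F k) (volume : Measure Plane) := by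
    intro k
    have hc := hφ.1.continuous
    refine Continuous.integrable_of_hasCompactSupport (by simp only [hF]; fun_prop) ?_
    exact hφ.2.comp_left (g := fun t : ℝ => (2 * t) ^ (2 * (k + 1)) / (2 * (k + 1)).factorial)
      (by simp)
  have hFle : ∀ k, ∫ x, F k x ≤ (1 / 2) ^ k * (4 * ∫ x, φ x ^ 2) := by
    intro k
    have e : ∀ x, F k x = 4 ^ (k + 1) / (2 * (k + 1)).factorial * φ x ^ (2 * (k + 1)) := by
      intro x
      simp only [hF, mul_pow, pow_mul]
      norm_num
      ring
    simp_rw [e, integral_const_mul]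
    have hfac : ((k + 1).factorial : ℝ) ^ 2 ≤ (2 * (k + 1)).factorial := by
      have := Nat.le_of_dvd (Nat.factorial_pos _)
        (Nat.factorial_mul_factorial_dvd_factorial_add (k + 1) (k + 1))
      rw [← two_mul, ← sq] at this
      exact_mod_cast this
    have hsmall : 4 * (C * ∫ x, ‖planeGradient φ x‖ ^ 2) ≤ 1 / 2 := by
      rw [le_div_iff₀ (by positivity)] at hD
      linarith
    calc _ ≤ (4 : ℝ) ^ (k + 1) / (2 * (k + 1)).factorial *
          ((C * ∫ x, ‖planeGradient φ x‖ ^ 2) ^ k * ((2 * (k + 1)).factorial : ℝ) *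
            ∫ x, φ x ^ 2) := by
          gcongr
          exact (h φ hφ k).trans (by gcongr)
      _ = (4 * (C * ∫ x, ‖planeGradient φ x‖ ^ 2)) ^ k * (4 * ∫ x, φ x ^ 2) := by
          field_simp
          ring
      _ ≤ _ := by gcongr
  have hgeo := hasSum_geometric_two.mul_right (4 * ∫ x, φ x ^ 2)
  have hsum : Summable fun k => ∫ x, ‖F k x‖ := by
    simp_rw [Real.norm_of_nonneg (hFnn _ _)]
    exact Summable.of_nonneg_of_le (fun k => integral_nonneg (hFnn k)) hFle hgeo.summable
  have hcosh : ∀ x, ∑' k, F k x = Real.cosh (2 * φ x) - 1 := by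
    intro x
    have := (hasSum_nat_add_iff' 1).2 (Real.hasSum_cosh (2 * φ x))
    simpa using this.tsum_eq
  have := hasSum_integral_of_summable_integral_norm hFint hsum
  simp_rw [hcosh] at this
  refine (hasSum_le hFle this hgeo).trans (le_of_eq ?_)
  ring

theorem IsTestFunction.lintegral_sq_exp_sub_one_le {φ : Plane → ℝ} (hφ : IsTestFunction φ)
    {M : ℝ} (h : ∫ x, (Real.cosh (2 * φ x) - 1) ≤ M) :
    ∫⁻ x, ENNReal.ofReal ((Real.exp (φ x) - 1) ^ 2) ≤ ENNReal.ofReal (2 * M) := by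
  have hint : Integrable (fun x => 2 * (Real.cosh (2 * φ x) - 1)) (volume : Measure Plane) := by
    have hc := hφ.1.continuous
    have hcosh := Real.continuous_cosh
    refine Continuous.integrable_of_hasCompactSupport (by fun_prop) ?_
    exact hφ.2.comp_left (g := fun t : ℝ => 2 * (Real.cosh (2 * t) - 1)) (by simp)
  calc _ ≤ ∫⁻ x, ENNReal.ofReal (2 * (Real.cosh (2 * φ x) - 1)) :=
        lintegral_mono fun x => ENNReal.ofReal_le_ofReal (sq_exp_sub_one_le _)
    _ = ENNReal.ofReal (∫ x, 2 * (Real.cosh (2 * φ x) - 1)) := by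
        rw [ofReal_integral_eq_lintegral_ofReal hint]
        exact Filter.Eventually.of_forall fun x => (sq_nonneg _).trans (sq_exp_sub_one_le (φ x))
    _ ≤ _ := by
        rw [integral_const_mul]
        exact ENNReal.ofReal_le_ofReal (by linarith)

namespace W12

theorem norm_toL2_sq (u : W12) : ‖toL2 u‖ ^ 2 = ∫ x, u.toFun x ^ 2 := by
  rw [← real_inner_self_eq_norm_sq, inner_toL2]
  simp_rw [sq]

theorem norm_gradL2_sq (u : W12) : ‖gradL2 u‖ ^ 2 = ∫ x, ‖u.grad x‖ ^ 2 := by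
  rw [← real_inner_self_eq_norm_sq, inner_gradL2]
  simp_rw [← inner_plane, real_inner_self_eq_norm_sq]

theorem norm_sq_eq_add (u : W12) : ‖u‖ ^ 2 = ‖toL2 u‖ ^ 2 + ‖gradL2 u‖ ^ 2 := by
  rw [norm_sq_eq, norm_toL2_sq, norm_gradL2_sq]

theorem norm_toL2_ofTest_sq {φ : Plane → ℝ} (hφ : IsTestFunction φ) :
    ‖toL2 (ofTest hφ)‖ ^ 2 = ∫ x, φ x ^ 2 := by
  rw [norm_toL2_sq]
  exact integral_congr_ae ((ofTest_toFun hφ).mono fun x hx => by simp only [hx])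

theorem norm_gradL2_ofTest_sq {φ : Plane → ℝ} (hφ : IsTestFunction φ) :
    ‖gradL2 (ofTest hφ)‖ ^ 2 = ∫ x, ‖planeGradient φ x‖ ^ 2 := by
  rw [norm_gradL2_sq]
  exact integral_congr_ae ((ofTest_grad hφ).mono fun x hx => by simp only [hx])

theorem exists_tendsto_ofTest (u : W12) : ∃ (φ : ℕ → Plane → ℝ) (hφ : ∀ n, IsTestFunction (φ n)),
    Filter.Tendsto (fun n => ofTest (hφ n)) Filter.atTop (nhds u) ∧
    ∀ᵐ x, Filter.Tendsto (fun n => φ n x) Filter.atTop (nhds (u.toFun x)) := by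
  obtain ⟨v, hv, hlim⟩ := mem_closure_iff_seq_limit.1 (dense_testSubmodule u)
  choose φ hφ hφv using hv
  obtain rfl : (fun n => ofTest (hφ n)) = v := funext hφv
  have h1 : Filter.Tendsto (fun n => toL2 (ofTest (hφ n))) Filter.atTop (nhds (toL2 u)) :=
    (toL2.continuous.tendsto u).comp hlim
  obtain ⟨ns, hns, hae⟩ := (tendstoInMeasure_of_tendsto_Lp h1).exists_seq_tendsto_ae
  refine ⟨fun n => φ (ns n), fun n => hφ (ns n), hlim.comp hns.tendsto_atTop, ?_⟩
  filter_upwards [hae, ae_all_iff.2 fun n => ofTest_toFun (hφ n)] with x hx hx'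
  refine hx.congr fun n => ?_
  exact hx' (ns n)

/-- Integral bounds pass from test functions to `W^{1,2}` by density and Fatou's lemma. -/
theorem lintegral_comp_le {F : ℝ → ℝ} (hF : Continuous F) {b : W12 → ℝ} (hb : Continuous b)
    {u : W12}
    (H : ∀ᶠ v in nhds u, ∀ (φ : Plane → ℝ) (hφ : IsTestFunction φ), v = ofTest hφ →
      ∫⁻ x, ENNReal.ofReal (F (φ x)) ≤ ENNReal.ofReal (b v)) :
    ∫⁻ x, ENNReal.ofReal (F (u.toFun x)) ≤ ENNReal.ofReal (b u) := by
  have hF' : Continuous fun t => ENNReal.ofReal (F t) := ENNReal.continuous_ofReal.comp hF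
  have hb' : Continuous fun v => ENNReal.ofReal (b v) := ENNReal.continuous_ofReal.comp hb
  obtain ⟨φ, hφ, hlim, hae⟩ := exists_tendsto_ofTest u
  calc ∫⁻ x, ENNReal.ofReal (F (u.toFun x))
      = ∫⁻ x, Filter.liminf (fun n => ENNReal.ofReal (F (φ n x))) Filter.atTop := by
        refine lintegral_congr_ae ?_
        filter_upwards [hae] with x hx
        exact ((hF'.tendsto _).comp hx).liminf_eq.symm
    _ ≤ Filter.liminf (fun n => ∫⁻ x, ENNReal.ofReal (F (φ n x))) Filter.atTop :=
        lintegral_liminf_le fun n => (hF'.comp (hφ n).1.continuous).measurable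
    _ ≤ Filter.liminf (fun n => ENNReal.ofReal (b (ofTest (hφ n)))) Filter.atTop := by
        refine Filter.liminf_le_liminf ?_
        filter_upwards [hlim.eventually H] with n hn
        exact hn _ (hφ n) rfl
    _ = ENNReal.ofReal (b u) := ((hb'.tendsto _).comp hlim).liminf_eq

/-- The Ladyzhenskaya inequality `∫ u⁴ ≤ C ‖∇u‖₂² ‖u‖₂²` on the plane. -/
theorem exists_integral_pow_four_le : ∃ C : ℝ, 0 < C ∧ ∀ u : W12,
    Integrable (fun x => u.toFun x ^ 4) (volume : Measure Plane) ∧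
    ∫ x, u.toFun x ^ 4 ≤ C * ‖gradL2 u‖ ^ 2 * ‖toL2 u‖ ^ 2 := by
  obtain ⟨C, hC, h⟩ := exists_integral_pow_le_factorial
  refine ⟨4 * C, by positivity, fun u => ?_⟩
  have hle : ∫⁻ x, ENNReal.ofReal (u.toFun x ^ 4) ≤
      ENNReal.ofReal (4 * C * ‖gradL2 u‖ ^ 2 * ‖toL2 u‖ ^ 2) := by
    refine lintegral_comp_le (F := fun t => t ^ 4)
      (b := fun v => 4 * C * ‖gradL2 v‖ ^ 2 * ‖toL2 v‖ ^ 2)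
      (by fun_prop) (by fun_prop) (Filter.Eventually.of_forall ?_)
    rintro _ φ hφ rfl
    have hint : Integrable (fun x => φ x ^ 4) (volume : Measure Plane) :=
      (hφ.pow 3).1.continuous.integrable_of_hasCompactSupport (hφ.pow 3).2
    rw [← ofReal_integral_eq_lintegral_ofReal hint
      (Filter.Eventually.of_forall fun x => by positivity), norm_gradL2_ofTest_sq,
      norm_toL2_ofTest_sq]
    refine ENNReal.ofReal_le_ofReal ((h φ hφ 1).trans (le_of_eq ?_))
    rw [Nat.factorial_two]
    push_cast
    ring
  have hmeas : AEStronglyMeasurable (fun x => u.toFun x ^ 4) (volume : Measure Plane) :=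
    u.memLp_toFun.1.pow 4
  have hint : Integrable (fun x => u.toFun x ^ 4) (volume : Measure Plane) := by
    refine (lintegral_ofReal_ne_top_iff_integrable hmeas
      (Filter.Eventually.of_forall fun x => by positivity)).1 (ne_top_of_le_ne_top ?_ hle)
    exact ENNReal.ofReal_ne_top
  refine ⟨hint, ?_⟩
  rw [← ofReal_integral_eq_lintegral_ofReal hint
    (Filter.Eventually.of_forall fun x => by positivity)] at hle
  exact (ENNReal.ofReal_le_ofReal_iff (by positivity)).1 hle

theorem exists_memLp_exp_sub_one_of_norm_lt : ∃ r : ℝ, 0 < r ∧ ∀ u : W12, ‖u‖ < r →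
    MemLp (fun x => Real.exp (u.toFun x) - 1) 2 (volume : Measure Plane) := by
  obtain ⟨ε, hε, h⟩ := exists_integral_cosh_le
  refine ⟨Real.sqrt ε, Real.sqrt_pos.2 hε, fun u hu => ?_⟩
  have hmeas : AEStronglyMeasurable (fun x => Real.exp (u.toFun x) - 1)
      (volume : Measure Plane) :=
    (Real.continuous_exp.comp_aestronglyMeasurable u.memLp_toFun.1).sub
      aestronglyMeasurable_const
  have hle : ∫⁻ x, ENNReal.ofReal ((Real.exp (u.toFun x) - 1) ^ 2) ≤
      ENNReal.ofReal (2 * (8 * ‖toL2 u‖ ^ 2)) := by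
    refine lintegral_comp_le (F := fun t => (Real.exp t - 1) ^ 2)
      (b := fun v => 2 * (8 * ‖toL2 v‖ ^ 2))
      (by fun_prop) (by fun_prop) ?_
    filter_upwards [continuous_norm.tendsto u |>.eventually (gt_mem_nhds hu)] with v hv φ hφ hvφ
    subst hvφ
    refine hφ.lintegral_sq_exp_sub_one_le ?_
    rw [norm_toL2_ofTest_sq]
    refine h φ hφ ?_
    rw [← norm_gradL2_ofTest_sq hφ]
    have h1 := norm_sq_eq_add (ofTest hφ)
    have h2 := (Real.lt_sqrt (norm_nonneg _)).1 hv
    nlinarith [sq_nonneg ‖toL2 (ofTest hφ)‖]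
  refine (memLp_two_iff_integrable_sq hmeas).2 ?_
  refine (lintegral_ofReal_ne_top_iff_integrable (hmeas.pow 2)
    (Filter.Eventually.of_forall fun x => sq_nonneg _)).1 (ne_top_of_le_ne_top ?_ hle)
  exact ENNReal.ofReal_ne_top

/-- The exponential is a map `W^{1,2} → 1 + L²`. Writing `u = φ + w` with `φ` a test function
and `w` small, `e^u - 1 = e^φ (e^w - 1) + (e^φ - 1)`, where `φ` is bounded. -/
theorem memLp_exp_sub_one (u : W12) :
    MemLp (fun x => Real.exp (u.toFun x) - 1) 2 (volume : Measure Plane) := by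
  obtain ⟨r, hr, h⟩ := exists_memLp_exp_sub_one_of_norm_lt
  obtain ⟨_, ⟨φ, hφ, rfl⟩, hdist⟩ := Metric.mem_closure_iff.1 (dense_testSubmodule u) r hr
  rw [dist_eq_norm] at hdist
  have hw := h _ hdist
  obtain ⟨M, hM⟩ := hφ.2.exists_bound_of_continuous hφ.1.continuous
  have hexp : Continuous fun x => Real.exp (φ x) := Real.continuous_exp.comp hφ.1.continuous
  have h1 : MemLp (fun x => Real.exp (φ x) * (Real.exp ((u - ofTest hφ).toFun x) - 1)) 2
      (volume : Measure Plane) := by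
    refine hw.of_le_mul (c := Real.exp M) (hexp.aestronglyMeasurable.mul hw.1)
      (Filter.Eventually.of_forall fun x => ?_)
    rw [norm_mul, Real.norm_of_nonneg (Real.exp_pos _).le]
    gcongr
    exact (le_abs_self _).trans (hM x)
  have h2 : MemLp (fun x => Real.exp (φ x) - 1) 2 (volume : Measure Plane) :=
    (hexp.sub continuous_const).memLp_of_hasCompactSupport
      (hφ.2.comp_left (g := fun t : ℝ => Real.exp t - 1) (by simp))
  refine (h1.add h2).ae_eq ?_
  filter_upwards [toFun_sub u (ofTest hφ), ofTest_toFun hφ] with x h3 h4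
  rw [Pi.add_apply, h3, h4, mul_sub, ← Real.exp_add]
  ring_nf

end W12

/-! ### The functional and its derivative -/

theorem abs_exp_sub_one_le (t : ℝ) : |Real.exp t - 1| ≤ Real.exp |t| - 1 := by
  rcases le_total 0 t with h | h
  · rw [abs_of_nonneg h, abs_of_nonneg (by linarith [Real.add_one_le_exp t])]
  · have h1 : Real.exp t ≤ 1 := Real.exp_le_one_iff.2 h
    have h2 := Real.add_one_le_exp (-t)
    have h3 := Real.add_one_le_exp t
    rw [abs_of_nonpos h, abs_of_nonpos (by linarith)]
    linarith

theorem exp_abs_add_abs_sub_one_le (a b : ℝ) : |Real.exp (|a| + |b|) - 1| ≤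
    |Real.exp (a + b) - 1| + |Real.exp (a - b) - 1| + |Real.exp (-(a + b)) - 1| +
      |Real.exp (-(a - b)) - 1| := by
  have h1 := abs_nonneg (Real.exp (a + b) - 1)
  have h2 := abs_nonneg (Real.exp (a - b) - 1)
  have h3 := abs_nonneg (Real.exp (-(a + b)) - 1)
  have h4 := abs_nonneg (Real.exp (-(a - b)) - 1)
  rcases abs_cases a with ⟨ha, _⟩ | ⟨ha, _⟩ <;> rcases abs_cases b with ⟨hb, _⟩ | ⟨hb, _⟩
  · rw [show |a| + |b| = a + b by rw [ha, hb]]; linarith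
  · rw [show |a| + |b| = a - b by rw [ha, hb]; ring]; linarith
  · rw [show |a| + |b| = -(a - b) by rw [ha, hb]; ring]; linarith
  · rw [show |a| + |b| = -(a + b) by rw [ha, hb]; ring]; linarith

namespace W12

theorem memLp_exp_abs_add_abs_sub_one (u h : W12) :
    MemLp (fun x => Real.exp (|u.toFun x| + |h.toFun x|) - 1) 2 (volume : Measure Plane) := by
  have hadd : MemLp (fun x => |Real.exp ((u + h).toFun x) - 1| + |Real.exp ((u - h).toFun x) - 1| +
      |Real.exp ((-(u + h)).toFun x) - 1| + |Real.exp ((-(u - h)).toFun x) - 1|) 2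
      (volume : Measure Plane) :=
    (((memLp_exp_sub_one (u + h)).norm.add (memLp_exp_sub_one (u - h)).norm).add
      (memLp_exp_sub_one (-(u + h))).norm).add (memLp_exp_sub_one (-(u - h))).norm
  refine hadd.mono ?_ ?_
  · exact (Real.continuous_exp.comp_aestronglyMeasurable
      (u.memLp_toFun.1.norm.add h.memLp_toFun.1.norm)).sub aestronglyMeasurable_const
  · filter_upwards [toFun_add u h, toFun_sub u h, toFun_neg (u + h), toFun_neg (u - h)]
      with x h1 h2 h3 h4
    rw [h3, h4, h1, h2]
    exact (exp_abs_add_abs_sub_one_le _ _).trans (le_abs_self _)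

theorem integrable_exp_sub_one_sub (u : W12) :
    Integrable (fun x => Real.exp (u.toFun x) - 1 - u.toFun x) (volume : Measure Plane) := by
  refine (u.memLp_toFun.integrable_mul u.memLp_exp_sub_one).mono
    (u.memLp_exp_sub_one.1.sub u.memLp_toFun.1) (Filter.Eventually.of_forall fun x => ?_)
  rw [Pi.mul_apply, Real.norm_eq_abs, Real.norm_eq_abs,
    abs_of_nonneg (by linarith [Real.add_one_le_exp (u.toFun x)])]
  refine le_trans ?_ (le_abs_self _)
  -- `e^t - 1 - t ≤ t (e^t - 1)` is `1 - t ≤ e^{-t}` multiplied by `e^t`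
  have h1 := Real.add_one_le_exp (-u.toFun x)
  have h2 : Real.exp (u.toFun x) * Real.exp (-u.toFun x) = 1 := by rw [← Real.exp_add]; simp
  nlinarith [Real.exp_pos (u.toFun x)]

theorem integrable_norm_grad_sq (u : W12) :
    Integrable (fun x => ‖u.grad x‖ ^ 2) (volume : Measure Plane) :=
  (memLp_two_iff_integrable_sq_norm u.memLp_grad.1).1 u.memLp_grad

end W12

section

variable {ς : Plane → ℝ}

theorem integrable_actionDensity (hς : MemLp ς 2 (volume : Measure Plane)) (u : W12) :
    Integrable (actionDensity ς u) (volume : Measure Plane) := by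
  have h := ((u.integrable_norm_grad_sq.const_mul (1 / 2)).add u.integrable_exp_sub_one_sub).sub
    (hς.integrable_mul u.memLp_toFun)
  refine h.congr (Filter.Eventually.of_forall fun x => ?_)
  simp only [actionDensity, Pi.add_apply, Pi.sub_apply, Pi.mul_apply]
  ring

theorem integrable_variationDensity (hς : MemLp ς 2 (volume : Measure Plane)) (u h : W12) :
    Integrable (variationDensity ς u h) (volume : Measure Plane) :=
  ((u.integrable_sum_grad_mul h).add (h.memLp_toFun.integrable_mul u.memLp_exp_sub_one)).sub
    (hς.integrable_mul h.memLp_toFun)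

/-- The derivative of the functional at `u`, represented by `∇u` and `e^u - 1 - ς` in `L²`. -/
def actionDeriv (hς : MemLp ς 2 (volume : Measure Plane)) (u : W12) : W12 →L[ℝ] ℝ :=
  (innerSL ℝ (W12.gradL2 u)).comp W12.gradL2 +
    (innerSL ℝ ((u.memLp_exp_sub_one.sub hς).toLp _)).comp W12.toL2

theorem actionDeriv_apply (hς : MemLp ς 2 (volume : Measure Plane)) (u h : W12) :
    actionDeriv hς u h = ∫ x, variationDensity ς u h x := by
  have h1 : actionDeriv hς u h = inner ℝ (W12.gradL2 u) (W12.gradL2 h) +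
      inner ℝ ((u.memLp_exp_sub_one.sub hς).toLp _) (W12.toL2 h) := rfl
  have h2 : inner ℝ ((u.memLp_exp_sub_one.sub hς).toLp _) (W12.toL2 h) =
      ∫ x, h.toFun x * (Real.exp (u.toFun x) - 1 - ς x) := by
    rw [L2.inner_def]
    refine integral_congr_ae ?_
    filter_upwards [(u.memLp_exp_sub_one.sub hς).coeFn_toLp] with x hx
    rw [hx, W12.coeFn_toL2]
    simp
  have hi : Integrable (fun x => h.toFun x * (Real.exp (u.toFun x) - 1 - ς x))
      (volume : Measure Plane) := h.memLp_toFun.integrable_mul (u.memLp_exp_sub_one.sub hς)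
  rw [h1, h2, W12.inner_gradL2, ← integral_add (u.integrable_sum_grad_mul h) hi]
  refine integral_congr_ae (Filter.Eventually.of_forall fun x => ?_)
  simp only [variationDensity]
  ring

/-- Differentiation under the integral sign: for `|t| < 1` the derivative of the density along
`u + t h` is dominated by products of square integrable functions. -/
theorem hasLineDerivAt_action (hς : MemLp ς 2 (volume : Measure Plane)) (u h : W12) :
    HasLineDerivAt ℝ (action ς) (actionDeriv hς u h) u h := by
  set F : ℝ → Plane → ℝ := fun t x => (1 / 2) * ‖u.grad x + t • h.grad x‖ ^ 2 +
    Real.exp (u.toFun x + t * h.toFun x) - ς x * (u.toFun x + t * h.toFun x) -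
      (u.toFun x + t * h.toFun x) - 1 with hF
  set F' : ℝ → Plane → ℝ := fun t x => inner ℝ (u.grad x + t • h.grad x) (h.grad x) +
    h.toFun x * (Real.exp (u.toFun x + t * h.toFun x) - 1) - ς x * h.toFun x with hF'
  have hFt : ∀ t, actionDensity ς (u + t • h) =ᵐ[volume] F t := by
    intro t
    filter_upwards [W12.toFun_add u (t • h), W12.grad_add u (t • h), W12.toFun_smul t h,
      W12.grad_smul t h] with x h1 h2 h3 h4
    simp only [actionDensity, hF]
    rw [h1, h2, h3, h4]
  have hF0 : variationDensity ς u h = F' 0 := by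
    funext x
    simp only [variationDensity, hF', zero_smul, zero_mul, add_zero, W12.inner_plane]
  have hder : ∀ x t, HasDerivAt (fun t => F t x) (F' t x) t := by
    intro x t
    have e1 : HasDerivAt (fun t : ℝ => u.grad x + t • h.grad x) (h.grad x) t := by
      simpa using ((hasDerivAt_id t).smul_const (h.grad x)).const_add (u.grad x)
    have e2 : HasDerivAt (fun t : ℝ => u.toFun x + t * h.toFun x) (h.toFun x) t := by
      simpa using ((hasDerivAt_id t).mul_const (h.toFun x)).const_add (u.toFun x)
    have e3 := ((((e1.norm_sq.const_mul (1 / 2)).add e2.exp).sub (e2.const_mul (ς x))).sub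
      e2).sub_const 1
    refine e3.congr_deriv ?_
    simp only [hF']
    ring
  have hmeas : ∀ t, AEStronglyMeasurable (F t) (volume : Measure Plane) := fun t =>
    (integrable_actionDensity hς (u + t • h)).1.congr (hFt t)
  have hkey := hasDerivAt_integral_of_dominated_loc_of_deriv_le (F := F) (F' := F') (x₀ := (0 : ℝ))
    (μ := (volume : Measure Plane)) (s := Metric.ball 0 1)
    (bound := fun x => (‖u.grad x‖ + ‖h.grad x‖) * ‖h.grad x‖ +
      |h.toFun x| * (Real.exp (|u.toFun x| + |h.toFun x|) - 1) + |ς x| * |h.toFun x|)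
    (Metric.ball_mem_nhds _ one_pos) (Filter.Eventually.of_forall hmeas)
    ((integrable_actionDensity hς (u + (0 : ℝ) • h)).congr (hFt 0))
    (hF0 ▸ (integrable_variationDensity hς u h).1)
    (Filter.Eventually.of_forall fun x t ht => ?_) ?_
    (Filter.Eventually.of_forall fun x t _ => hder x t)
  · have h2 := hkey.2
    rw [← hF0, ← actionDeriv_apply hς] at h2
    have hact : (fun t : ℝ => action ς (u + t • h)) = fun t => ∫ x, F t x :=
      funext fun t => integral_congr_ae (hFt t)
    rw [HasLineDerivAt, hact]
    exact h2
  · have ht' : |t| ≤ 1 := by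
      have := mem_ball_zero_iff.1 ht
      exact this.le
    have hth : |t * h.toFun x| ≤ |h.toFun x| := by
      rw [abs_mul]
      exact mul_le_of_le_one_left (abs_nonneg _) ht'
    simp only [hF', Real.norm_eq_abs]
    refine (abs_sub _ _).trans (add_le_add ((abs_add_le _ _).trans (add_le_add ?_ ?_)) ?_)
    · refine (abs_real_inner_le_norm _ _).trans ?_
      gcongr
      refine (norm_add_le _ _).trans ?_
      rw [norm_smul]
      gcongr
      exact mul_le_of_le_one_left (norm_nonneg _) ht'
    · rw [abs_mul]
      gcongr
      refine (abs_exp_sub_one_le _).trans ?_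
      gcongr
      exact (abs_add_le _ _).trans (by gcongr)
    · rw [abs_mul]
  · exact (((u.memLp_grad.norm.add h.memLp_grad.norm).integrable_mul h.memLp_grad.norm).add
      (h.memLp_toFun.norm.integrable_mul (u.memLp_exp_abs_add_abs_sub_one h))).add
      (hς.norm.integrable_mul h.memLp_toFun.norm)

/-- The graph of the functional lies strictly above its tangents: the difference is the integral
of `½ |∇(v - u)|² + e^u (e^(v - u) - 1 - (v - u)) ≥ 0`, which vanishes only for `v = u`. -/
theorem action_add_deriv_lt (hς : MemLp ς 2 (volume : Measure Plane)) {u v : W12} (huv : u ≠ v) :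
    action ς u + actionDeriv hς u (v - u) < action ς v := by
  set I : Plane → ℝ := fun x =>
    actionDensity ς v x - (actionDensity ς u x + variationDensity ς u (v - u) x) with hI
  have hint : Integrable I (volume : Measure Plane) :=
    (integrable_actionDensity hς v).sub
      ((integrable_actionDensity hς u).add (integrable_variationDensity hς u (v - u)))
  have hIint : ∫ x, I x = action ς v - (action ς u + actionDeriv hς u (v - u)) := by
    rw [actionDeriv_apply, action, action, ← integral_add (integrable_actionDensity hς u)
      (integrable_variationDensity hς u (v - u))]
    exact integral_sub (integrable_actionDensity hς v)
      ((integrable_actionDensity hς u).add (integrable_variationDensity hς u (v - u)))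
  have hIeq : ∀ᵐ x, I x = (1 / 2) * ‖v.grad x - u.grad x‖ ^ 2 + Real.exp (u.toFun x) *
      (Real.exp (v.toFun x - u.toFun x) - 1 - (v.toFun x - u.toFun x)) := by
    filter_upwards [W12.toFun_sub v u, W12.grad_sub v u] with x h1 h2
    simp only [hI, actionDensity, variationDensity]
    have h3 : Real.exp (v.toFun x) =
        Real.exp (u.toFun x) * Real.exp (v.toFun x - u.toFun x) := by
      rw [← Real.exp_add]
      ring_nf
    rw [← W12.inner_plane, h1, h2, inner_sub_right, norm_sub_sq_real,
      real_inner_comm (u.grad x) (v.grad x), real_inner_self_eq_norm_sq, h3]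
    ring
  have hexp : ∀ t : ℝ, 0 ≤ Real.exp t - 1 - t := fun t => by linarith [Real.add_one_le_exp t]
  have hnn : 0 ≤ᵐ[volume] I := by
    filter_upwards [hIeq] with x hx
    rw [hx]
    have := hexp (v.toFun x - u.toFun x)
    simp only [Pi.zero_apply]
    positivity
  by_contra hcon
  have h0 : ∫ x, I x = 0 := le_antisymm (by linarith) (integral_nonneg_of_ae hnn)
  rw [integral_eq_zero_iff_of_nonneg_ae hnn hint] at h0
  refine huv (W12.ext_of_toFun ?_)
  filter_upwards [h0, hIeq] with x hx hx'
  by_contra hne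
  have hlt := Real.add_one_lt_exp (sub_ne_zero.2 (Ne.symm hne))
  have hpos : 0 < Real.exp (u.toFun x) *
      (Real.exp (v.toFun x - u.toFun x) - 1 - (v.toFun x - u.toFun x)) :=
    mul_pos (Real.exp_pos _) (by linarith)
  rw [hx, Pi.zero_apply] at hx'
  have := sq_nonneg ‖v.grad x - u.grad x‖
  linarith

theorem action_add_deriv_le (hς : MemLp ς 2 (volume : Measure Plane)) (u v : W12) :
    action ς u + actionDeriv hς u (v - u) ≤ action ς v := by
  rcases eq_or_ne u v with rfl | h
  · simp
  · exact (action_add_deriv_lt hς h).le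

end

/-- A function with strict subgradients everywhere is strictly convex. -/
theorem strictConvexOn_of_subgradient {E : Type*} [AddCommGroup E] [Module ℝ E]
    {f : E → ℝ} (L : E → E →ₗ[ℝ] ℝ) (h : ∀ u v, u ≠ v → f u + L u (v - u) < f v) :
    StrictConvexOn ℝ Set.univ f := by
  refine ⟨convex_univ, fun x _ y _ hxy a b ha hb hab => ?_⟩
  set z := a • x + b • y
  have hb' : b = 1 - a := by linarith
  have hz1 : x - z = b • (x - y) := by
    simp only [z, hb']
    module
  have hz2 : y - z = -(a • (x - y)) := by
    simp only [z, hb']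
    module
  have hxy' := sub_ne_zero.2 hxy
  have h1 := h z x (fun e => smul_ne_zero hb.ne' hxy' (by rw [← hz1, e, sub_self]))
  have h2 := h z y (fun e => smul_ne_zero ha.ne' hxy' (by
    rw [← neg_eq_zero, ← hz2, e, sub_self]))
  rw [hz1, map_smul, smul_eq_mul] at h1
  rw [hz2, map_neg, map_smul, smul_eq_mul] at h2
  simp only [smul_eq_mul]
  have e : f z = a * (f z + b * L z (x - y)) + b * (f z + -(a * L z (x - y))) := by
    rw [hb']
    ring
  rw [e]
  gcongr

/-! ### Coercivity -/

/-- `t (e^t - 1) ≥ t² / (1 + |t|) ≥ 2λt² - λ²t²(1 + |t|)`, together with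
`2 |t|³ ≤ τ t² + t⁴ / τ`. -/
theorem mul_exp_sub_one_ge {l τ : ℝ} (hτ : 0 < τ) (t : ℝ) :
    (2 * l - l ^ 2 * (1 + τ / 2)) * t ^ 2 - l ^ 2 / (2 * τ) * t ^ 4 ≤ t * (Real.exp t - 1) := by
  have h1 : t ^ 2 / (1 + |t|) ≤ t * (Real.exp t - 1) := by
    rw [div_le_iff₀ (by positivity)]
    rcases le_total 0 t with h | h
    · have := Real.add_one_le_exp t
      rw [abs_of_nonneg h]
      nlinarith [mul_nonneg h (by linarith : 0 ≤ Real.exp t - 1 - t), mul_nonneg h h,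
        mul_nonneg (mul_nonneg h h) (by linarith : 0 ≤ Real.exp t - 1)]
    · -- for `t ≤ 0`, `e^t (1 - t) ≤ 1` gives `(1 - e^t)(1 - t) ≥ -t`
      have e1 := Real.add_one_le_exp (-t)
      have e2 : Real.exp t * Real.exp (-t) = 1 := by rw [← Real.exp_add]; simp
      have e3 : Real.exp t * (1 - t) ≤ 1 := by nlinarith [Real.exp_pos t]
      rw [abs_of_nonpos h]
      nlinarith
  have h2 : 2 * l * t ^ 2 - l ^ 2 * t ^ 2 * (1 + |t|) ≤ t ^ 2 / (1 + |t|) := by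
    rw [le_div_iff₀ (by positivity)]
    nlinarith [mul_nonneg (sq_nonneg t) (sq_nonneg (l * (1 + |t|) - 1))]
  have h3 : t ^ 2 * |t| ≤ τ / 2 * t ^ 2 + t ^ 4 / (2 * τ) := by
    rw [← sub_nonneg]
    have : τ / 2 * t ^ 2 + t ^ 4 / (2 * τ) - t ^ 2 * |t| = t ^ 2 * (τ - |t|) ^ 2 / (2 * τ) := by
      have : t ^ 4 = t ^ 2 * |t| ^ 2 := by rw [sq_abs]; ring
      rw [this]
      field_simp
      ring
    rw [this]
    positivity
  have h4 := mul_le_mul_of_nonneg_left h3 (sq_nonneg l)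
  have h5 : l ^ 2 / (2 * τ) * t ^ 4 = l ^ 2 * (t ^ 4 / (2 * τ)) := by ring
  rw [h5]
  linarith

/-- The nonlinear term controls the `L²` norm up to a factor that is linear in `‖∇u‖₂`. -/
theorem W12.exists_integral_mul_exp_sub_one_ge : ∃ κ : ℝ, 0 < κ ∧ ∀ u : W12,
    ‖toL2 u‖ ^ 2 ≤ (1 + κ * (1 + ‖gradL2 u‖)) * ∫ x, u.toFun x * (Real.exp (u.toFun x) - 1) := by
  obtain ⟨C, hC, h⟩ := exists_integral_pow_four_le
  refine ⟨(1 + C) / 2, by positivity, fun u => ?_⟩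
  obtain ⟨hint4, h4⟩ := h u
  have hD := norm_nonneg (gradL2 u)
  have hX := norm_nonneg (toL2 u)
  set D := ‖gradL2 u‖
  set X := ‖toL2 u‖ with hXdef
  set M := 1 + (1 + C) / 2 * (1 + D) with hM
  have hMpos : 0 < M := by positivity
  have hint2 := u.memLp_toFun.integrable_sq
  have hint : Integrable (fun x => u.toFun x * (Real.exp (u.toFun x) - 1))
      (volume : Measure Plane) := u.memLp_toFun.integrable_mul u.memLp_exp_sub_one
  have hτ : 0 < 1 + D := by positivity
  have hmono := integral_mono ((hint2.const_mul
    (2 * M⁻¹ - M⁻¹ ^ 2 * (1 + (1 + D) / 2))).sub (hint4.const_mul (M⁻¹ ^ 2 / (2 * (1 + D))))) hint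
    (fun x => mul_exp_sub_one_ge (l := M⁻¹) hτ (u.toFun x))
  have hsub : ∫ x, ((2 * M⁻¹ - M⁻¹ ^ 2 * (1 + (1 + D) / 2)) * u.toFun x ^ 2 -
      M⁻¹ ^ 2 / (2 * (1 + D)) * u.toFun x ^ 4) =
      (2 * M⁻¹ - M⁻¹ ^ 2 * (1 + (1 + D) / 2)) * X ^ 2 -
      M⁻¹ ^ 2 / (2 * (1 + D)) * ∫ x, u.toFun x ^ 4 := by
    rw [integral_sub (hint2.const_mul _) (hint4.const_mul _), integral_const_mul,
      integral_const_mul, hXdef, norm_toL2_sq]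
  have hmono' : (2 * M⁻¹ - M⁻¹ ^ 2 * (1 + (1 + D) / 2)) * X ^ 2 -
      M⁻¹ ^ 2 / (2 * (1 + D)) * ∫ x, u.toFun x ^ 4 ≤
      ∫ x, u.toFun x * (Real.exp (u.toFun x) - 1) := hsub ▸ hmono
  have h5 : M⁻¹ ^ 2 / (2 * (1 + D)) * ∫ x, u.toFun x ^ 4 ≤ M⁻¹ ^ 2 * (C / 2 * (1 + D)) * X ^ 2 := by
    calc _ ≤ M⁻¹ ^ 2 / (2 * (1 + D)) * (C * (1 + D) ^ 2 * X ^ 2) := by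
          gcongr
          refine h4.trans ?_
          gcongr
          linarith
      _ = _ := by
          field_simp
  have h6 : M⁻¹ * X ^ 2 ≤ ∫ x, u.toFun x * (Real.exp (u.toFun x) - 1) := by
    have e : (2 * M⁻¹ - M⁻¹ ^ 2 * (1 + (1 + D) / 2)) * X ^ 2 -
        M⁻¹ ^ 2 * (C / 2 * (1 + D)) * X ^ 2 = M⁻¹ * X ^ 2 := by
      have : 1 + (1 + D) / 2 + C / 2 * (1 + D) = M := by rw [hM]; ring
      have e' : (2 * M⁻¹ - M⁻¹ ^ 2 * (1 + (1 + D) / 2)) * X ^ 2 -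
        M⁻¹ ^ 2 * (C / 2 * (1 + D)) * X ^ 2 =
        (2 * M⁻¹ - M⁻¹ ^ 2 * (1 + (1 + D) / 2 + C / 2 * (1 + D))) * X ^ 2 := by ring
      rw [e', this]
      field_simp
      ring
    linarith
  rwa [inv_mul_le_iff₀ hMpos] at h6

/-- The arithmetic of coercivity on a large circle `X² + D² = R²`: with `M = 1 + κ (1 + D)`,
either `X ≥ 2 (s + 1) M`, and then `B ≥ X² / M` dominates `s X`, or `X` is at most linear in `D`,
and then `D²` does. -/
theorem exists_one_le_sq_add_sub {κ s : ℝ} (hκ : 0 < κ) (hs0 : 0 ≤ s) :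
    ∃ R : ℝ, 0 < R ∧ ∀ X D B : ℝ, 0 ≤ X → 0 ≤ D → R ^ 2 = X ^ 2 + D ^ 2 →
      X ^ 2 ≤ (1 + κ * (1 + D)) * B → 1 ≤ D ^ 2 + B - s * X := by
  obtain ⟨a, ha⟩ : ∃ a, a = 2 * (s + 1) * (1 + κ) := ⟨_, rfl⟩
  obtain ⟨b, hb⟩ : ∃ b, b = 2 * (s + 1) * κ := ⟨_, rfl⟩
  have ha0 : 2 ≤ a := by
    rw [ha]
    nlinarith [mul_nonneg hs0 hκ.le]
  have hb0 : 0 ≤ b := by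
    rw [hb]
    positivity
  obtain ⟨D₀, hD₀⟩ : ∃ D₀, D₀ = 1 + s * (a + b) := ⟨_, rfl⟩
  have hD₀1 : 1 ≤ D₀ := by
    have : 0 ≤ s * (a + b) := by positivity
    linarith
  refine ⟨a + b * D₀ + D₀, by positivity, fun X D B hX hD hnorm hBu => ?_⟩
  have hM : 0 < 1 + κ * (1 + D) := by positivity
  have hB0 : 0 ≤ B := by
    by_contra hneg
    push Not at hneg
    nlinarith [sq_nonneg X]
  have hab : a + b * D = 2 * (s + 1) * (1 + κ * (1 + D)) := by
    rw [ha, hb]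
    ring
  rcases le_or_gt (a + b * D) X with hcase | hcase
  · -- `X² ≤ M B` and `2 (s + 1) M ≤ X` give `2 (s + 1) X ≤ B`
    have hXpos : 0 < X := lt_of_lt_of_le (by positivity) hcase
    have h1 : 2 * (s + 1) * X ≤ B := by
      rw [hab] at hcase
      have h2 : 2 * (s + 1) * (1 + κ * (1 + D)) * X ≤ (1 + κ * (1 + D)) * B := by
        nlinarith
      have h3 : (1 + κ * (1 + D)) * (2 * (s + 1) * X) ≤ (1 + κ * (1 + D)) * B := by linarith
      exact le_of_mul_le_mul_left h3 hM
    have h2 : 1 ≤ X := by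
      have : 0 ≤ b * D := by positivity
      linarith
    nlinarith [sq_nonneg D, mul_nonneg hs0 hX]
  · have hDD : D₀ ≤ D := by
      by_contra hlt
      push Not at hlt
      have h1 : X ≤ a + b * D₀ := hcase.le.trans (by gcongr)
      have h2 : X ^ 2 ≤ (a + b * D₀) ^ 2 := by gcongr
      have h3 : D ^ 2 ≤ D₀ ^ 2 := by gcongr
      have h4 : 0 < (a + b * D₀) * D₀ := by positivity
      nlinarith
    have h1 : s * X ≤ s * (a + b * D) := by gcongr
    have h2 : s * (a + b * D) ≤ s * (a + b) * D := by
      have : a ≤ a * D := le_mul_of_one_le_right (by positivity) (by linarith)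
      have : s * a ≤ s * (a * D) := by gcongr
      linarith
    have h3 : 1 ≤ D * (D - s * (a + b)) := by
      have : 1 ≤ D - s * (a + b) := by linarith
      nlinarith
    nlinarith

/-- The radial derivative is bounded below on a large sphere: at `u` it is at least
`‖∇u‖₂² + ∫ u (e^u - 1) - ‖ς‖₂ ‖u‖₂`. -/
theorem exists_le_actionDeriv_self {ς : Plane → ℝ} (hς : MemLp ς 2 (volume : Measure Plane)) :
    ∃ R : ℝ, 0 < R ∧ ∃ δ : ℝ, 0 < δ ∧ ∀ u : W12, ‖u‖ = R → δ ≤ actionDeriv hς u u := by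
  obtain ⟨κ, hκ, hB⟩ := W12.exists_integral_mul_exp_sub_one_ge
  obtain ⟨R, hR, harith⟩ := exists_one_le_sq_add_sub hκ (norm_nonneg (hς.toLp ς))
  refine ⟨R, hR, 1, one_pos, fun u hu => ?_⟩
  have hlow := harith _ _ _ (norm_nonneg _) (norm_nonneg _) (hu ▸ W12.norm_sq_eq_add u) (hB u)
  have e1 : ∫ x, ς x * u.toFun x ≤ ‖hς.toLp ς‖ * ‖W12.toL2 u‖ := by
    refine le_trans (le_of_eq ?_) (real_inner_le_norm (hς.toLp ς) (W12.toL2 u))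
    rw [L2.inner_def]
    refine integral_congr_ae ?_
    filter_upwards [hς.coeFn_toLp] with x hx
    rw [hx, W12.coeFn_toL2]
    simp [mul_comm]
  have e2 : actionDeriv hς u u = ‖W12.gradL2 u‖ ^ 2 +
      (∫ x, u.toFun x * (Real.exp (u.toFun x) - 1)) - ∫ x, ς x * u.toFun x := by
    have i1 := u.integrable_sum_grad_mul u
    have i2 : Integrable (fun x => u.toFun x * (Real.exp (u.toFun x) - 1))
        (volume : Measure Plane) := u.memLp_toFun.integrable_mul u.memLp_exp_sub_one
    have i12 : Integrable (fun x => (∑ i : Fin 2, u.grad x i * u.grad x i) +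
        u.toFun x * (Real.exp (u.toFun x) - 1)) (volume : Measure Plane) := i1.add i2
    have i3 : Integrable (fun x => ς x * u.toFun x) (volume : Measure Plane) :=
      hς.integrable_mul u.memLp_toFun
    rw [actionDeriv_apply, ← real_inner_self_eq_norm_sq, W12.inner_gradL2,
      ← integral_add i1 i2, ← integral_sub i12 i3]
    rfl
  linarith

/-! ### Minimization on a Hilbert space -/

/-- A decreasing sequence of nonempty closed convex sets in a ball of a Hilbert space has a common
point: the points of minimal norm form a Cauchy sequence by the parallelogram law. -/
theorem exists_forall_mem_of_antitone_convex {H : Type*} [NormedAddCommGroup H]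
    [InnerProductSpace ℝ H] [CompleteSpace H] {K : ℕ → Set H} (hanti : Antitone K)
    (hne : ∀ n, (K n).Nonempty) (hconv : ∀ n, Convex ℝ (K n)) (hclosed : ∀ n, IsClosed (K n))
    {R : ℝ} (hR : ∀ n, ∀ x ∈ K n, ‖x‖ ≤ R) : ∃ x, ∀ n, x ∈ K n := by
  have hmin : ∀ n, ∃ p ∈ K n, ∀ x ∈ K n, ‖p‖ ≤ ‖x‖ := by
    intro n
    obtain ⟨p, hp, hpe⟩ :=
      exists_norm_eq_iInf_of_complete_convex (hne n) (hclosed n).isComplete (hconv n) 0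
    refine ⟨p, hp, fun x hx => ?_⟩
    rw [zero_sub, norm_neg] at hpe
    rw [hpe]
    refine (ciInf_le ⟨0, ?_⟩ (⟨x, hx⟩ : K n)).trans (by simp)
    rintro _ ⟨y, rfl⟩
    positivity
  choose p hp hpmin using hmin
  have hmono : Monotone fun n => ‖p n‖ ^ 2 := fun m n hmn => by
    have := hpmin m (p n) (hanti hmn (hp n))
    dsimp only
    gcongr
  have hbdd : BddAbove (Set.range fun n => ‖p n‖ ^ 2) := by
    refine ⟨R ^ 2, ?_⟩
    rintro _ ⟨n, rfl⟩
    have := hR n _ (hp n)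
    dsimp only
    gcongr
  have hlim := tendsto_atTop_ciSup hmono hbdd
  set A := ⨆ n, ‖p n‖ ^ 2
  have hpar : ∀ m n, m ≤ n → ‖p m - p n‖ ^ 2 ≤ 2 * (A - ‖p m‖ ^ 2) := by
    intro m n hmn
    have hmid : (1 / 2 : ℝ) • p m + (1 / 2 : ℝ) • p n ∈ K m :=
      hconv m (hp m) (hanti hmn (hp n)) (by norm_num) (by norm_num) (by norm_num)
    have h1 := hpmin m _ hmid
    rw [← smul_add, norm_smul, Real.norm_of_nonneg (by norm_num)] at h1
    have h2 := parallelogram_law_with_norm ℝ (p m) (p n)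
    have h3 : ‖p n‖ ^ 2 ≤ A := le_ciSup hbdd n
    have h4 : (2 * ‖p m‖) ^ 2 ≤ ‖p m + p n‖ ^ 2 := by
      gcongr
      linarith
    nlinarith
  have hcauchy : CauchySeq p := by
    refine Metric.cauchySeq_iff'.2 fun ε hε => ?_
    obtain ⟨N, hN⟩ := (hlim.eventually (lt_mem_nhds (show A - ε ^ 2 / 2 < A by
      have : 0 < ε ^ 2 := by positivity
      linarith))).exists
    refine ⟨N, fun n hn => ?_⟩
    rw [dist_comm, dist_eq_norm]
    refine lt_of_pow_lt_pow_left₀ 2 hε.le ((hpar N n hn).trans_lt ?_)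
    linarith
  obtain ⟨x, hx⟩ := cauchySeq_tendsto_of_complete hcauchy
  refine ⟨x, fun n => (hclosed n).mem_of_tendsto hx ?_⟩
  filter_upwards [Filter.eventually_ge_atTop n] with m hm
  exact hanti hm (hp m)

/-- A function on a Hilbert space that has a subgradient at every point, positive in the radial
direction on some sphere, attains its minimum. Its sublevel sets are intersections of closed
half-spaces, hence closed and convex, and its values outside the ball exceed one on the sphere. -/
theorem exists_forall_le_of_subgradient {H : Type*} [NormedAddCommGroup H]
    [InnerProductSpace ℝ H] [CompleteSpace H] {f : H → ℝ} (L : H → H →L[ℝ] ℝ)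
    (hL : ∀ u v, f u + L u (v - u) ≤ f v) {R : ℝ} (hR : 0 < R)
    (hpos : ∀ u, ‖u‖ = R → 0 ≤ L u u) : ∃ u, ∀ v, f u ≤ f v := by
  have hball : ∀ v, ∃ u, ‖u‖ ≤ R ∧ f u ≤ f v := by
    intro v
    rcases le_or_gt ‖v‖ R with h | h
    · exact ⟨v, h, le_rfl⟩
    · have hv : 0 < ‖v‖ := hR.trans h
      have hu : ‖(R / ‖v‖) • v‖ = R := by
        rw [norm_smul, Real.norm_of_nonneg (by positivity)]
        field_simp
      refine ⟨(R / ‖v‖) • v, hu.le, ?_⟩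
      have h1 := hL ((R / ‖v‖) • v) v
      have h2 := hpos _ hu
      have h3 : v - (R / ‖v‖) • v = (‖v‖ / R - 1) • ((R / ‖v‖) • v) := by
        rw [smul_smul, sub_mul, one_mul, sub_smul, div_mul_div_cancel₀ hR.ne', div_self hv.ne',
          one_smul]
      rw [h3, map_smul, smul_eq_mul] at h1
      have h4 : 0 ≤ ‖v‖ / R - 1 := by
        rw [sub_nonneg, one_le_div hR]
        exact h.le
      nlinarith [mul_nonneg h4 h2]
  have hbdd : BddBelow (Set.range f) := by
    refine ⟨f 0 - ‖L 0‖ * R, ?_⟩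
    rintro _ ⟨v, rfl⟩
    obtain ⟨u, hu, huv⟩ := hball v
    have h1 := hL 0 u
    rw [sub_zero] at h1
    have h2 := ((abs_le.1 ((L 0).le_opNorm u)).1)
    have h3 : ‖L 0‖ * ‖u‖ ≤ ‖L 0‖ * R := by gcongr
    linarith
  have hsub : ∀ c, {v | f v ≤ c} = ⋂ u, {v | f u + L u (v - u) ≤ c} := by
    intro c
    ext v
    simp only [Set.mem_iInter, Set.mem_ofPred_eq]
    exact ⟨fun h u => (hL u v).trans h, fun h => by simpa using h v⟩
  have hclosed : ∀ c, IsClosed {v | f v ≤ c} := fun c => by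
    rw [hsub]
    exact isClosed_iInter fun u => isClosed_le (by fun_prop) continuous_const
  have hconv : ∀ c, Convex ℝ {v | f v ≤ c} := fun c => by
    rw [hsub]
    refine convex_iInter fun u => ?_
    have : {v | f u + L u (v - u) ≤ c} = {v | L u v ≤ c - f u + L u u} := by
      ext v
      simp only [Set.mem_ofPred_eq, map_sub]
      constructor <;> intro h <;> linarith
    rw [this]
    exact convex_halfSpace_le (L u).isLinear _
  obtain ⟨u, hu⟩ := exists_forall_mem_of_antitone_convex
    (K := fun n : ℕ => {v | f v ≤ (⨅ v, f v) + 1 / ((n : ℝ) + 1)} ∩ Metric.closedBall 0 R)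
    (fun m n hmn v hv => ⟨le_trans (show f v ≤ _ from hv.1)
      (add_le_add le_rfl (Nat.one_div_le_one_div hmn)), hv.2⟩)
    (fun n => by
      obtain ⟨v, hv⟩ := exists_lt_of_ciInf_lt (show (⨅ v, f v) < (⨅ v, f v) + 1 / ((n : ℝ) + 1) by
        have : 0 < 1 / ((n : ℝ) + 1) := by positivity
        linarith)
      obtain ⟨u, hu, huv⟩ := hball v
      exact ⟨u, huv.trans hv.le, mem_closedBall_zero_iff.2 hu⟩)
    (fun n => (hconv _).inter (convex_closedBall _ _))
    (fun n => (hclosed _).inter Metric.isClosed_closedBall)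
    (fun n x hx => mem_closedBall_zero_iff.1 hx.2)
  refine ⟨u, fun v => le_trans ?_ (ciInf_le hbdd v)⟩
  have hlim := (tendsto_one_div_add_atTop_nhds_zero_nat (𝕜 := ℝ)).const_add (⨅ v, f v)
  rw [add_zero] at hlim
  exact ge_of_tendsto' hlim fun n => (hu n).1

/-! ### Weak solutions and minimizers -/

section

variable {ς : Plane → ℝ}

theorem isGlobalMinimizer_iff_actionDeriv_eq_zero (hς : MemLp ς 2 (volume : Measure Plane))
    (u : W12) : IsGlobalMinimizer ς u ↔ actionDeriv hς u = 0 := by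
  constructor
  · intro hu
    ext h
    have hmin : IsLocalMin (fun t : ℝ => action ς (u + t • h)) 0 :=
      Filter.Eventually.of_forall fun t => by
        simp only [zero_smul, add_zero]
        exact hu _
    exact hmin.hasDerivAt_eq_zero (hasLineDerivAt_action hς u h)
  · intro hu v
    simpa [hu] using action_add_deriv_le hς u v

theorem W12.locallyIntegrable_exp (u : W12) :
    LocallyIntegrable (fun x => Real.exp (u.toFun x)) (volume : Measure Plane) := by
  have h := (u.memLp_exp_sub_one.locallyIntegrable (by norm_num)).add
    (locallyIntegrable_const (1 : ℝ))
  refine h.congr (Filter.Eventually.of_forall fun x => ?_)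
  simp

theorem actionDeriv_ofTest (hς : MemLp ς 2 (volume : Measure Plane)) (u : W12)
    {φ : Plane → ℝ} (hφ : IsTestFunction φ) :
    actionDeriv hς u (W12.ofTest hφ) = (∫ x, ∑ i : Fin 2, u.grad x i * partialDeriv i φ x) +
      ∫ x, (Real.exp (u.toFun x) - ς x - 1) * φ x := by
  have i1 : Integrable (fun x => ∑ i : Fin 2, u.grad x i * partialDeriv i φ x)
      (volume : Measure Plane) :=
    integrable_finsetSum _ fun i _ =>
      (u.memLp_grad_coord i).integrable_mul (hφ.memLp_partialDeriv i)
  have i2 : Integrable (fun x => (Real.exp (u.toFun x) - ς x - 1) * φ x)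
      (volume : Measure Plane) := by
    refine ((u.memLp_exp_sub_one.sub hς).integrable_mul hφ.memLp).congr
      (Filter.Eventually.of_forall fun x => ?_)
    simp only [Pi.mul_apply, Pi.sub_apply]
    ring
  rw [actionDeriv_apply, ← integral_add i1 i2]
  refine integral_congr_ae ?_
  filter_upwards [W12.ofTest_toFun hφ, W12.ofTest_grad hφ] with x h1 h2
  simp only [variationDensity, h1, h2, planeGradient_apply]
  ring

/-- The weak equation says that the derivative of the functional vanishes on test functions; as
these are dense and the derivative is bounded, it vanishes identically. -/
theorem isWeakSolution_iff_actionDeriv_eq_zero (hς : MemLp ς 2 (volume : Measure Plane))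
    (u : W12) : IsWeakSolution ς u ↔ actionDeriv hς u = 0 := by
  constructor
  · rintro ⟨-, h⟩
    refine ContinuousLinearMap.ext_on (s := (W12.testSubmodule : Set W12)) ?_ ?_
    · exact W12.dense_testSubmodule.mono Submodule.subset_span
    · rintro _ ⟨φ, hφ, rfl⟩
      rw [actionDeriv_ofTest, ← h φ hφ]
      simp
  · intro h
    refine ⟨u.locallyIntegrable_exp, fun φ hφ => ?_⟩
    have h1 := actionDeriv_ofTest hς u hφ
    rw [h, zero_apply] at h1
    linarith

end

theorem theorem1 (ς : Plane → ℝ) (hς : MemLp ς 2 (volume : Measure Plane))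
    (hlt : Real.sqrt (∫ x, |ς x| ^ 2) < Real.sqrt (2 / Real.pi)) :
    -- existence and uniqueness of the weak solution
    (∃! u : W12, IsWeakSolution ς u) ∧
    -- the functional is finite
    (∀ u : W12, Integrable (actionDensity ς u) (volume : Measure Plane)) ∧
    -- it is strictly convex
    StrictConvexOn ℝ Set.univ (action ς) ∧
    -- it is Gateaux differentiable, with the expected derivative
    (∀ u : W12, ∃ L : W12 →L[ℝ] ℝ, ∀ h : W12,
      Integrable (variationDensity ς u h) (volume : Measure Plane) ∧
      L h = ∫ x, variationDensity ς u h x ∧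
      HasLineDerivAt ℝ (action ς) (L h) u h) ∧
    -- its radial derivative is bounded below by a positive constant on some sphere
    (∃ R : ℝ, 0 < R ∧ ∃ δ : ℝ, 0 < δ ∧ ∀ u : W12, ‖u‖ = R →
      δ ≤ ∫ x, variationDensity ς u u x) ∧
    -- it has a unique global minimizer, and this is the weak solution
    (∃! u : W12, IsGlobalMinimizer ς u) ∧
    (∀ u : W12, IsWeakSolution ς u ↔ IsGlobalMinimizer ς u) := by
  have hconv : StrictConvexOn ℝ Set.univ (action ς) :=
    strictConvexOn_of_subgradient (fun u => (actionDeriv hς u : W12 →ₗ[ℝ] ℝ))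
      fun u v huv => action_add_deriv_lt hς huv
  obtain ⟨R, hR, δ, hδ, hcoer⟩ := exists_le_actionDeriv_self hς
  have hmin : ∃! u : W12, IsGlobalMinimizer ς u := by
    obtain ⟨u, hu⟩ := exists_forall_le_of_subgradient (actionDeriv hς) (action_add_deriv_le hς) hR
      fun u hu => hδ.le.trans (hcoer u hu)
    exact ⟨u, hu, fun v hv => hconv.eq_of_isMinOn (fun w _ => hv w) (fun w _ => hu w)
      (Set.mem_univ _) (Set.mem_univ _)⟩
  have hiff : ∀ u : W12, IsWeakSolution ς u ↔ IsGlobalMinimizer ς u := fun u =>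
    (isWeakSolution_iff_actionDeriv_eq_zero hς u).trans
      (isGlobalMinimizer_iff_actionDeriv_eq_zero hς u).symm
  refine ⟨?_, integrable_actionDensity hς, hconv, fun u => ⟨actionDeriv hς u, fun h =>
    ⟨integrable_variationDensity hς u h, actionDeriv_apply hς u h, hasLineDerivAt_action hς u h⟩⟩,
    ⟨R, hR, δ, hδ, fun u hu => ?_⟩, hmin, hiff⟩
  · simpa only [hiff] using hmin
  · rw [← actionDeriv_apply hς]
    exact hcoer u hu

end
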